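/- Let $d\ge 0$ be an integer. For $f\in\mathcal S'(\mathbb R^n)$ and a window $g\in\mathcal S(\mathbb R^n)\setminus\{0\}$, let $V_gf(x,\omega)=\langle f, e^{2\pi i\omega\cdot(\,\cdot\,)}g(\cdot-x)\rangle$ (bracket conjugate-linear in the second entry) be the short-time Fourier transform. For $1\le p,q\le\infty$ the modulation space $M^{p,q}(\mathbb R^n)$ consists of all $f\in\mathcal S'(\mathbb R^n)$ with $$\bigl\|\,\omega\mapsto\|V_gf(\cdot,\omega)\|_{L^p(dx)}\bigr\|_{L^q(d\omega)}<\infty,$$ and the Wiener amalgam space $W(\mathcal FL^p,L^q)(\mathbb R^n)$ of all $f\in\mathcal S'(\mathbb R^n)$ with $$\bigl\|\,x\mapsto\|V_gf(x,\cdot)\|_{L^p(d\omega)}\bigr\|_{L^q(dx)}<\infty.$$ For an invertible real $2d\times 2d$ matrix $A$ and $f\in\mathcal S'(\mathbb R^d)$ put $\mathcal B_Af=\mathcal F_2\mathfrak T_A(f\otimes\overline f)\in\mathcal S'(\mathbb R^{2d})$, where $\mathfrak T_AF(x,y)=F(A(x,y))$ and $\mathcal F_2F(x,\omega)=\int_{\mathbb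 R^d}e^{-2\pi i\omega\cdot y}F(x,y)\,dy$ are extended to $\mathcal S'(\mathbb R^{2d})$ by duality; formally, with $d\times d$ blocks $A_{ij}$, $$\mathcal B_Af(x,\omega)=\int_{\mathbb R^d}e^{-2\pi i\omega\cdot y}f(A_{11}x+A_{12}y)\,\overline{f(A_{21}x+A_{22}y)}\,dy .$$ Let $Wf=\mathcal B_{A}f$ for $A=\begin{pmatrix}I&\frac12I\\ I&-\frac12I\end{pmatrix}$ be the Wigner distribution. For $M\in\mathbb R^{d\times d}$ let $$A_M=\begin{pmatrix}I&M+\frac12I\\ I&M-\frac12I\end{pmatrix},\qquad \chi_M(\xi,\eta)=e^{2\pi i\,\eta\cdot M\xi},\qquad \theta_M=\mathcal F_\sigma\chi_M\in\mathcal S'(\mathbb R^{2d}),$$ where $\mathcal F_\sigma F(x,\omega)=\mathcal FF(\omega,-x)$ is the symplectic Fourier transform, with $\mathcal FF(\zeta)=\int_{\mathbb R^{2d}} e^{-2\pi i z\cdot\zeta}F(z)\,dz$, extended to tempered distributions. Theorem. Let $M\in\mathbb R^{d\times d}$ be invertible, and let the spaces below be described with an arbitrary fixed window $g\in\mathcal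 S(\mathbb R^{2d})\setminus\{0\}$. Then $$\theta_M\in M^{1,\infty}(\mathbb R^{2d})\cap W(\mathcal FL^1,L^\infty)(\mathbb R^{2d}).$$ Moreover, for every $f\in\mathcal S'(\mathbb R^d)$ and all $1\le p,q\le\infty$, $$Wf\in M^{p,q}(\mathbb R^{2d})\iff \mathcal B_{A_M}f\in M^{p,q}(\mathbb R^{2d}).$$ -/

import Mathlib

noncomputable section

open SchwartzMap MeasureTheory
open scoped ContDiff FourierTransform LineDeriv ENNReal

namespace CohenClass

section Aux

variable {V W : Type} [NormedAddCommGroup V] [NormedSpace ℝ V]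

theorem exists_sup_seminorm_comp_le (P : 𝓢(V, ℂ) →L[ℂ] 𝓢(V, ℂ)) (s : Finset (ℕ × ℕ)) :
    ∃ (s' : Finset (ℕ × ℕ)) (C : ℝ), 0 ≤ C ∧ ∀ Φ : 𝓢(V, ℂ),
      s.sup (schwartzSeminormFamily ℂ V ℂ) (P Φ) ≤
        C * s'.sup (schwartzSeminormFamily ℂ V ℂ) Φ := by
  have hw := schwartz_withSeminorms ℂ V ℂ
  have hs : Continuous fun Φ => s.sup (schwartzSeminormFamily ℂ V ℂ) Φ := by
    classical
    induction s using Finset.induction_on with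
    | empty => simpa using continuous_const
    | insert a t _ ih =>
      simp only [Finset.sup_insert, Seminorm.sup_apply]
      exact (hw.continuous_seminorm a).sup ih
  obtain ⟨s', C, -, h⟩ := Seminorm.bound_of_continuous hw
    ((s.sup (schwartzSeminormFamily ℂ V ℂ)).comp (P : 𝓢(V, ℂ) →ₗ[ℂ] 𝓢(V, ℂ)))
    (hs.comp P.continuous)
  exact ⟨s', C, C.2, fun Φ => h Φ⟩

theorem exists_norm_le_sup_seminorm (G : 𝓢(V, ℂ) →L[ℂ] ℂ) :
    ∃ (s : Finset (ℕ × ℕ)) (C : ℝ), 0 ≤ C ∧ ∀ Φ : 𝓢(V, ℂ),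
      ‖G Φ‖ ≤ C * s.sup (schwartzSeminormFamily ℂ V ℂ) Φ := by
  have hw := schwartz_withSeminorms ℂ V ℂ
  obtain ⟨s', C, -, h⟩ := Seminorm.bound_of_continuous hw
    ((normSeminorm ℂ ℂ).comp (G : 𝓢(V, ℂ) →ₗ[ℂ] ℂ))
    (continuous_norm.comp G.continuous)
  exact ⟨s', C, C.2, fun Φ => h Φ⟩

variable [NormedAddCommGroup W] [InnerProductSpace ℝ W] [FiniteDimensional ℝ W]

theorem contDiff_of_intertwining (T : 𝓢(V, ℂ) → W → ℂ) (D : W → 𝓢(V, ℂ) →L[ℂ] 𝓢(V, ℂ))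
    (hD : ∀ Φ z, ∃ L : W →L[ℝ] ℂ, HasFDerivAt (T Φ) L z ∧ ∀ m, L m = T (D m Φ) z)
    (Φ : 𝓢(V, ℂ)) : ContDiff ℝ ∞ (T Φ) := by
  rw [contDiff_infty]
  intro n
  induction n generalizing Φ with
  | zero =>
    rw [Nat.cast_zero, contDiff_zero, continuous_iff_continuousAt]
    intro z
    obtain ⟨L, hL, -⟩ := hD Φ z
    exact hL.continuousAt
  | succ n ih =>
    rw [Nat.cast_succ, contDiff_succ_iff_fderiv_apply]
    refine ⟨fun z => ?_, by simp, fun m => ?_⟩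
    · obtain ⟨L, hL, -⟩ := hD Φ z
      exact hL.differentiableAt
    · convert ih (D m Φ) using 1
      ext z
      obtain ⟨L, hL, h⟩ := hD Φ z
      rw [hL.fderiv, h]

/-- A family of functions `T Φ` that is bounded by Schwartz seminorms of `Φ` and for which
differentiation and multiplication by coordinates can be moved onto `Φ` has Schwartz decay. -/
theorem decay_of_intertwining (T : 𝓢(V, ℂ) → W → ℂ)
    (hb : ∃ (s : Finset (ℕ × ℕ)) (C : ℝ), 0 ≤ C ∧ ∀ (Φ : 𝓢(V, ℂ)) (z : W),
      ‖T Φ z‖ ≤ C * s.sup (schwartzSeminormFamily ℂ V ℂ) Φ)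
    (hadd : ∀ (Φ Ψ : 𝓢(V, ℂ)) z, T (Φ + Ψ) z = T Φ z + T Ψ z)
    (D : W → 𝓢(V, ℂ) →L[ℂ] 𝓢(V, ℂ))
    (hD : ∀ Φ z, ∃ L : W →L[ℝ] ℂ, HasFDerivAt (T Φ) L z ∧ ∀ m, L m = T (D m Φ) z)
    (X : W → 𝓢(V, ℂ) →L[ℂ] 𝓢(V, ℂ))
    (hX : ∀ m Φ z, T (X m Φ) z = (inner ℝ m z : ℝ) * T Φ z) (n : ℕ × ℕ) :
    ∃ (s : Finset (ℕ × ℕ)) (C : ℝ), 0 ≤ C ∧ ∀ (Φ : 𝓢(V, ℂ)) (z : W),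
      ‖z‖ ^ n.1 * ‖iteratedFDeriv ℝ n.2 (T Φ) z‖ ≤
        C * s.sup (schwartzSeminormFamily ℂ V ℂ) Φ := by
  obtain ⟨k, n⟩ := n
  dsimp only
  have hsm := contDiff_of_intertwining T D hD
  let b := stdOrthonormalBasis ℝ W
  have hsum : ∀ {ι : Type} (t : Finset ι) (Φ : ι → 𝓢(V, ℂ)) z,
      T (∑ i ∈ t, Φ i) z = ∑ i ∈ t, T (Φ i) z := by
    intro ι t Φ z
    have h0 : T 0 z = 0 := by simpa using hadd 0 0 z
    classical
    induction t using Finset.induction_on with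
    | empty => simpa using h0
    | insert a t ha ih => rw [Finset.sum_insert ha, Finset.sum_insert ha, hadd, ih]
  induction n with
  | zero =>
    let Y : 𝓢(V, ℂ) →L[ℂ] 𝓢(V, ℂ) := ∑ i, (X (b i)).comp (X (b i))
    have hY : ∀ Φ z, T (Y Φ) z = (‖z‖ : ℂ) ^ 2 * T Φ z := by
      intro Φ z
      have h1 : Y Φ = ∑ i, X (b i) (X (b i) Φ) := by
        simp [Y]
      rw [h1, hsum]
      simp only [hX, ← mul_assoc]
      rw [← Finset.sum_mul]
      congr 1
      have h2 := b.sum_sq_norm_inner_right z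
      have h3 : ((∑ i, ‖(inner ℝ (b i) z : ℝ)‖ ^ 2 : ℝ) : ℂ) = ((‖z‖ ^ 2 : ℝ) : ℂ) := by rw [h2]
      push_cast at h3
      rw [← h3]
      refine Finset.sum_congr rfl fun i _ => ?_
      rw [← sq, ← Complex.ofReal_pow, ← Complex.ofReal_pow, Real.norm_eq_abs, sq_abs]
    have hYk : ∀ (j : ℕ) Φ z, T ((Y ^ j) Φ) z = (‖z‖ : ℂ) ^ (2 * j) * T Φ z := by
      intro j
      induction j with
      | zero => intro Φ z; simp
      | succ j ih =>
        intro Φ z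
        rw [pow_succ', mul_apply_eq_comp, hY, ih]
        ring
    obtain ⟨s, C, hC, h⟩ := hb
    obtain ⟨s', C', hC', h'⟩ := exists_sup_seminorm_comp_le (Y ^ k) s
    refine ⟨s ∪ s', C + C * C', by positivity, fun Φ z => ?_⟩
    rw [norm_iteratedFDeriv_zero]
    have e1 : ‖z‖ ^ (2 * k) * ‖T Φ z‖ = ‖T ((Y ^ k) Φ) z‖ := by
      rw [hYk, norm_mul, norm_pow, Complex.norm_real, norm_norm]
    have e2 : ‖z‖ ^ k ≤ 1 + ‖z‖ ^ (2 * k) := by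
      rw [mul_comm 2 k, pow_mul]; nlinarith [sq_nonneg (‖z‖ ^ k - 1), sq_nonneg (‖z‖ ^ k)]
    have m1 : s.sup (schwartzSeminormFamily ℂ V ℂ) Φ ≤
        (s ∪ s').sup (schwartzSeminormFamily ℂ V ℂ) Φ :=
      Finset.sup_mono (f := schwartzSeminormFamily ℂ V ℂ) Finset.subset_union_left Φ
    have m2 : s'.sup (schwartzSeminormFamily ℂ V ℂ) Φ ≤
        (s ∪ s').sup (schwartzSeminormFamily ℂ V ℂ) Φ :=
      Finset.sup_mono (f := schwartzSeminormFamily ℂ V ℂ) Finset.subset_union_right Φ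
    calc ‖z‖ ^ k * ‖T Φ z‖ ≤ (1 + ‖z‖ ^ (2 * k)) * ‖T Φ z‖ := by gcongr
      _ = ‖T Φ z‖ + ‖T ((Y ^ k) Φ) z‖ := by rw [add_mul, one_mul, e1]
      _ ≤ C * (s ∪ s').sup (schwartzSeminormFamily ℂ V ℂ) Φ +
          C * (C' * (s ∪ s').sup (schwartzSeminormFamily ℂ V ℂ) Φ) := by
        refine add_le_add ((h Φ z).trans (by gcongr)) ((h _ z).trans ?_)
        gcongr
        exact (h' Φ).trans (by gcongr)
      _ = _ := by ring
  | succ n ih =>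
    obtain ⟨s, C, hC, h⟩ := ih
    choose s' C' hC' h' using fun i => exists_sup_seminorm_comp_le (D (b i)) s
    let Λ : Fin (Module.finrank ℝ W) → ℂ →L[ℝ] (W →L[ℝ] ℂ) := fun i =>
      ContinuousLinearMap.smulRightL ℝ W ℂ (innerSL ℝ (b i))
    have hfd : ∀ Φ, fderiv ℝ (T Φ) = fun z => ∑ i, (Λ i ∘ T (D (b i) Φ)) z := by
      intro Φ
      ext z m
      obtain ⟨L, hL, hLm⟩ := hD Φ z
      rw [hL.fderiv]
      conv_lhs => rw [← b.sum_repr' m]; simp only [map_sum, map_smul]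
      simp only [hLm]
      simp [Λ]
    refine ⟨Finset.univ.sup s', ∑ i, ‖Λ i‖ * (C * C' i),
      Finset.sum_nonneg fun i _ => by have := hC' i; positivity, fun Φ z => ?_⟩
    rw [← norm_iteratedFDeriv_fderiv, hfd, iteratedFDeriv_fun_sum_apply, Finset.sum_mul]
    · calc ‖z‖ ^ k * ‖∑ i, iteratedFDeriv ℝ n (Λ i ∘ T (D (b i) Φ)) z‖
          ≤ ‖z‖ ^ k * ∑ i, ‖Λ i‖ * ‖iteratedFDeriv ℝ n (T (D (b i) Φ)) z‖ := by
            gcongr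
            refine (norm_sum_le _ _).trans (Finset.sum_le_sum fun i _ => ?_)
            exact (Λ i).norm_iteratedFDeriv_comp_left (N := ∞) (hsm _).contDiffAt
              (mod_cast le_top)
        _ = ∑ i, ‖Λ i‖ * (‖z‖ ^ k * ‖iteratedFDeriv ℝ n (T (D (b i) Φ)) z‖) := by
            rw [Finset.mul_sum]; exact Finset.sum_congr rfl fun i _ => by ring
        _ ≤ _ := by
            refine Finset.sum_le_sum fun i _ => ?_
            rw [mul_assoc]
            refine mul_le_mul_of_nonneg_left ((h _ z).trans ?_) (by positivity)
            rw [mul_assoc]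
            refine mul_le_mul_of_nonneg_left ((h' i Φ).trans ?_) hC
            refine mul_le_mul_of_nonneg_left ?_ (hC' i)
            exact Finset.sup_mono (f := schwartzSeminormFamily ℂ V ℂ)
              (Finset.le_sup (f := s') (Finset.mem_univ i)) Φ
    · intro i _
      exact ((Λ i).contDiff.comp (hsm _)).contDiffAt.of_le (mod_cast le_top)

/-- A continuous linear map between Schwartz spaces, from a family of functions that is bounded by
Schwartz seminorms and intertwines derivatives and multiplication by coordinates. -/
def mkIntertwining (T : 𝓢(V, ℂ) → W → ℂ)
    (hb : ∃ (s : Finset (ℕ × ℕ)) (C : ℝ), 0 ≤ C ∧ ∀ (Φ : 𝓢(V, ℂ)) (z : W),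
      ‖T Φ z‖ ≤ C * s.sup (schwartzSeminormFamily ℂ V ℂ) Φ)
    (hadd : ∀ (Φ Ψ : 𝓢(V, ℂ)) z, T (Φ + Ψ) z = T Φ z + T Ψ z)
    (hsmul : ∀ (a : ℂ) (Φ : 𝓢(V, ℂ)) z, T (a • Φ) z = a • T Φ z)
    (D : W → 𝓢(V, ℂ) →L[ℂ] 𝓢(V, ℂ))
    (hD : ∀ Φ z, ∃ L : W →L[ℝ] ℂ, HasFDerivAt (T Φ) L z ∧ ∀ m, L m = T (D m Φ) z)
    (X : W → 𝓢(V, ℂ) →L[ℂ] 𝓢(V, ℂ))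
    (hX : ∀ m Φ z, T (X m Φ) z = (inner ℝ m z : ℝ) * T Φ z) :
    𝓢(V, ℂ) →L[ℂ] 𝓢(W, ℂ) :=
  SchwartzMap.mkCLM T hadd hsmul (contDiff_of_intertwining T D hD)
    (decay_of_intertwining T hb hadd D hD X hX)

/-- Second order Taylor estimate for all iterated derivatives. -/
theorem norm_iteratedFDeriv_taylor_le {V F : Type} [NormedAddCommGroup V] [NormedSpace ℝ V]
    [NormedAddCommGroup F] [NormedSpace ℝ F] (n : ℕ) (f : V → F) (hf : ContDiff ℝ ∞ f)
    (z h : V) (C : ℝ) (hC : ∀ w ∈ segment ℝ z (z + h), ‖iteratedFDeriv ℝ (n + 2) f w‖ ≤ C) :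
    ‖iteratedFDeriv ℝ n (fun w => f (w + h) - f w - fderiv ℝ f w h) z‖ ≤ C * ‖h‖ * ‖h‖ := by
  induction n generalizing F with
  | zero =>
    rw [norm_iteratedFDeriv_zero]
    have hf' : ContDiff ℝ ∞ (fderiv ℝ f) := (contDiff_infty_iff_fderiv.1 hf).2
    have hd : Differentiable ℝ f := (contDiff_infty_iff_fderiv.1 hf).1
    have hd' : Differentiable ℝ (fderiv ℝ f) := (contDiff_infty_iff_fderiv.1 hf').1
    have hC0 : 0 ≤ C := (norm_nonneg _).trans (hC z (left_mem_segment ℝ _ _))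
    have key : ∀ w ∈ segment ℝ z (z + h), ‖fderiv ℝ f w - fderiv ℝ f z‖ ≤ C * ‖h‖ := by
      intro w hw
      have := (convex_segment z (z + h)).norm_image_sub_le_of_norm_hasFDerivWithin_le
        (f := fderiv ℝ f) (f' := fderiv ℝ (fderiv ℝ f)) (C := C)
        (fun x _ => (hd' x).hasFDerivAt.hasFDerivWithinAt)
        (fun x hx => by
          have := hC x hx
          rw [← norm_iteratedFDeriv_fderiv, ← norm_iteratedFDeriv_fderiv,
            norm_iteratedFDeriv_zero] at this
          exact this) (left_mem_segment ℝ _ _) hw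
      refine this.trans ?_
      gcongr
      have hh := norm_sub_le_of_mem_segment hw
      simpa using hh
    have := (convex_segment z (z + h)).norm_image_sub_le_of_norm_hasFDerivWithin_le'
      (f := f) (f' := fderiv ℝ f) (φ := fderiv ℝ f z)
      (fun x _ => (hd x).hasFDerivAt.hasFDerivWithinAt) key (left_mem_segment ℝ _ _)
      (right_mem_segment ℝ _ _)
    simpa using this
  | succ n ih =>
    have hf' : ContDiff ℝ ∞ (fderiv ℝ f) := (contDiff_infty_iff_fderiv.1 hf).2
    have hd : Differentiable ℝ f := (contDiff_infty_iff_fderiv.1 hf).1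
    have hd' : Differentiable ℝ (fderiv ℝ f) := (contDiff_infty_iff_fderiv.1 hf').1
    rw [← norm_iteratedFDeriv_fderiv]
    have e : fderiv ℝ (fun w => f (w + h) - f w - fderiv ℝ f w h) =
        fun w => fderiv ℝ f (w + h) - fderiv ℝ f w - fderiv ℝ (fderiv ℝ f) w h := by
      ext w m
      have h1 : HasFDerivAt (fun w => f (w + h)) (fderiv ℝ f (w + h)) w := by
        exact (hasFDerivAt_comp_add_right h).2 (hd (w + h)).hasFDerivAt
      have h3 : HasFDerivAt (fun w => fderiv ℝ f w h) ((fderiv ℝ (fderiv ℝ f) w).flip h) w := by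
        have := (hd' w).hasFDerivAt.clm_apply (hasFDerivAt_const h w)
        simpa using this
      rw [((h1.fun_sub (hd w).hasFDerivAt).fun_sub h3).fderiv]
      have hs : IsSymmSndFDerivAt ℝ f w :=
        hf.contDiffAt.isSymmSndFDerivAt (by simpa using ENat.LEInfty.out)
      simp [hs m h]
    rw [e]
    refine ih (fderiv ℝ f) hf' fun w hw => ?_
    rw [norm_iteratedFDeriv_fderiv]
    exact hC w hw

/-- Translating a Schwartz function is differentiable in the translation parameter, when tested
against a continuous linear functional. -/
theorem hasFDerivAt_translate [FiniteDimensional ℝ V] (G : 𝓢(V, ℂ) →L[ℂ] ℂ) (Φ : 𝓢(V, ℂ)) :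
    ∃ L : V →L[ℝ] ℂ, HasFDerivAt (fun a : V => G (Φ.compSubConstCLM ℂ (-a))) L 0 ∧
      ∀ m, L m = G (∂_{m} Φ) := by
  let L : V →ₗ[ℝ] ℂ :=
    { toFun := fun m => G (∂_{m} Φ)
      map_add' := fun m m' => by rw [LineDeriv.lineDerivOp_left_add, map_add]
      map_smul' := fun r m => by
        rw [LineDeriv.lineDerivOp_left_smul]
        have : r • (∂_{m} Φ) = (r : ℂ) • (∂_{m} Φ) := by ext; simp
        rw [this, map_smul]; simp }
  refine ⟨LinearMap.toContinuousLinearMap L, ?_, fun m => rfl⟩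
  obtain ⟨s, C, hC, h⟩ := exists_norm_le_sup_seminorm G
  have key : ∀ i : ℕ × ℕ, ∃ B : ℝ, 0 ≤ B ∧ ∀ a : V, ‖a‖ ≤ 1 →
      schwartzSeminormFamily ℂ V ℂ i (Φ.compSubConstCLM ℂ (-a) - Φ - ∂_{a} Φ) ≤
        B * ‖a‖ * ‖a‖ := by
    rintro ⟨k, n⟩
    let S := 2 ^ k * (Finset.Iic (k, n + 2)).sup (fun m => SchwartzMap.seminorm ℂ m.1 m.2) Φ
    have hS : 0 ≤ S := by positivity
    refine ⟨S, hS, fun a ha => ?_⟩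
    rw [schwartzSeminormFamily_apply]
    refine SchwartzMap.seminorm_le_bound ℂ k n _ (by positivity) fun z => ?_
    by_cases hz : ‖z‖ ^ k = 0
    · rw [hz, zero_mul]; positivity
    have hz' : 0 < ‖z‖ ^ k := lt_of_le_of_ne (by positivity) (Ne.symm hz)
    have hcoe : ⇑(Φ.compSubConstCLM ℂ (-a) - Φ - ∂_{a} Φ) =
        fun w => Φ (w + a) - Φ w - fderiv ℝ Φ w a := by
      ext w
      simp [SchwartzMap.lineDerivOp_apply_eq_fderiv]
    rw [hcoe]
    have := norm_iteratedFDeriv_taylor_le n Φ (Φ.smooth ⊤) z a (S / ‖z‖ ^ k) fun w hw => by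
      rw [le_div_iff₀ hz', mul_comm]
      refine le_trans ?_ (SchwartzMap.one_add_le_sup_seminorm_apply (𝕜 := ℂ) (m := (k, n + 2))
        le_rfl le_rfl Φ w)
      gcongr
      have hh := norm_sub_le_of_mem_segment hw
      have : ‖z‖ ≤ ‖w‖ + ‖w - z‖ := by
        have := norm_sub_le w (w - z); simpa using this
      simp at hh
      linarith
    calc _ ≤ ‖z‖ ^ k * (S / ‖z‖ ^ k * ‖a‖ * ‖a‖) := by gcongr
      _ = _ := by field_simp
  choose B hB hB' using key
  rw [hasFDerivAt_iff_isLittleO_nhds_zero]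
  refine Asymptotics.IsBigO.trans_isLittleO (g := fun a : V => ‖a‖ ^ 2) ?_ ?_
  · refine Asymptotics.IsBigO.of_bound (C * ∑ i ∈ s, B i) ?_
    filter_upwards [Metric.closedBall_mem_nhds (0 : V) one_pos] with a ha
    rw [mem_closedBall_zero_iff] at ha
    have e : G (Φ.compSubConstCLM ℂ (-(0 + a))) - G (Φ.compSubConstCLM ℂ (-0)) -
        (LinearMap.toContinuousLinearMap L) a =
        G (Φ.compSubConstCLM ℂ (-a) - Φ - ∂_{a} Φ) := by
      rw [map_sub, map_sub]; simp [L]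
    rw [e]
    refine (h _).trans ?_
    rw [mul_assoc]
    gcongr
    have hsum : 0 ≤ ∑ i ∈ s, B i := Finset.sum_nonneg fun i _ => hB i
    refine Seminorm.finset_sup_apply_le (by positivity) fun i hi => (hB' i a ha).trans ?_
    rw [norm_pow, norm_norm, mul_assoc, ← sq]
    gcongr
    exact Finset.single_le_sum (fun i _ => hB i) hi
  · have := Asymptotics.isLittleO_norm_pow_id (E' := V) (one_lt_two)
    exact this

end Aux

/-- The Euclidean space `ℝ^d`. -/
abbrev Rd (d : ℕ) : Type := EuclideanSpace ℝ (Fin d)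

/-- The Euclidean space `ℝ^{2d}`, with coordinates split into two blocks of length `d`. -/
abbrev Rdd (d : ℕ) : Type := EuclideanSpace ℝ (Fin d ⊕ Fin d)

section Coordinates

variable {d : ℕ}

/-- The first block `x` of `(x, y) ∈ ℝ^{2d}`. -/
def fstL : Rdd d →L[ℝ] Rd d :=
  LinearMap.toContinuousLinearMap
    { toFun := fun z => WithLp.toLp 2 fun i => z (Sum.inl i)
      map_add' := fun _ _ => rfl
      map_smul' := fun _ _ => rfl }

/-- The second block `y` of `(x, y) ∈ ℝ^{2d}`. -/
def sndL : Rdd d →L[ℝ] Rd d :=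
  LinearMap.toContinuousLinearMap
    { toFun := fun z => WithLp.toLp 2 fun i => z (Sum.inr i)
      map_add' := fun _ _ => rfl
      map_smul' := fun _ _ => rfl }

@[simp]
theorem fstL_apply (z : Rdd d) (i : Fin d) : fstL z i = z (Sum.inl i) := rfl

@[simp]
theorem sndL_apply (z : Rdd d) (i : Fin d) : sndL z i = z (Sum.inr i) := rfl

/-- The embedding `x ↦ (x, 0)`. -/
def inlL : Rd d →L[ℝ] Rdd d :=
  LinearMap.toContinuousLinearMap
    { toFun := fun x => WithLp.toLp 2 (Sum.elim x 0)
      map_add' := fun _ _ => by ext i; rcases i with i | i <;> simp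
      map_smul' := fun _ _ => by ext i; rcases i with i | i <;> simp }

/-- The embedding `y ↦ (0, y)`. -/
def inrL : Rd d →L[ℝ] Rdd d :=
  LinearMap.toContinuousLinearMap
    { toFun := fun y => WithLp.toLp 2 (Sum.elim 0 y)
      map_add' := fun _ _ => by ext i; rcases i with i | i <;> simp
      map_smul' := fun _ _ => by ext i; rcases i with i | i <;> simp }

/-- The point `(x, y) ∈ ℝ^{2d}`. -/
def pair (x y : Rd d) : Rdd d := WithLp.toLp 2 (Sum.elim x y)

theorem pair_eq (x y : Rd d) : pair x y = inlL x + inrL y := by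
  ext i; rcases i with i | i <;> simp [pair, inlL, inrL]

theorem fstL_pair (x y : Rd d) : fstL (pair x y) = x := by
  ext i; simp [pair]

theorem sndL_pair (x y : Rd d) : sndL (pair x y) = y := by
  ext i; simp [pair]

theorem pair_fstL_sndL (z : Rdd d) : pair (fstL z) (sndL z) = z := by
  ext i; rcases i with i | i <;> simp [pair]

theorem inner_eq_add (z w : Rdd d) :
    (inner ℝ z w : ℝ) = inner ℝ (fstL z) (fstL w) + inner ℝ (sndL z) (sndL w) := by
  simp [PiLp.inner_apply, Fintype.sum_sum_type]

theorem norm_sq_pair (x y : Rd d) : ‖pair x y‖ ^ 2 = ‖x‖ ^ 2 + ‖y‖ ^ 2 := by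
  simp only [← real_inner_self_eq_norm_sq, inner_eq_add, fstL_pair, sndL_pair]

theorem norm_snd_le_pair (x y : Rd d) : ‖y‖ ≤ ‖pair x y‖ := by
  refine le_of_sq_le_sq ?_ (norm_nonneg _)
  rw [norm_sq_pair]; nlinarith [sq_nonneg ‖x‖]

theorem norm_inrL_apply (y : Rd d) : ‖inrL y‖ = ‖y‖ := by
  have h : inrL y = pair 0 y := by rw [pair_eq]; simp
  have := norm_sq_pair 0 y
  rw [← h, norm_zero, zero_pow two_ne_zero, zero_add] at this
  exact (sq_eq_sq₀ (norm_nonneg _) (norm_nonneg _)).1 this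

theorem norm_inrL_le : ‖(inrL : Rd d →L[ℝ] Rdd d)‖ ≤ 1 :=
  ContinuousLinearMap.opNorm_le_bound _ zero_le_one fun y => by rw [norm_inrL_apply, one_mul]

end Coordinates

section Slice

variable {d : ℕ}

/-- The section `Φ_x(y) = Φ(x, y)` of a Schwartz function on `ℝ^{2d}`. -/
def slice (x : Rd d) : 𝓢(Rdd d, ℂ) →L[ℂ] 𝓢(Rd d, ℂ) :=
  SchwartzMap.compCLMOfAntilipschitz ℂ (K := 1) (g := fun y => pair x y)
    (by simp only [pair_eq]; fun_prop)
    (AntilipschitzWith.of_le_mul_dist fun y y' => by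
      simp [pair_eq, dist_eq_norm, ← map_sub, norm_inrL_apply])

@[simp]
theorem slice_apply (x : Rd d) (Φ : 𝓢(Rdd d, ℂ)) (y : Rd d) : slice x Φ y = Φ (pair x y) := rfl

theorem norm_iteratedFDeriv_slice_le (x : Rd d) (Φ : 𝓢(Rdd d, ℂ)) (n : ℕ) (y : Rd d) :
    ‖iteratedFDeriv ℝ n (slice x Φ) y‖ ≤ ‖iteratedFDeriv ℝ n Φ (pair x y)‖ := by
  have e : ⇑(slice x Φ) = (fun w => Φ (inlL x + w)) ∘ inrL := by
    ext y; simp [pair_eq]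
  have hc : ContDiff ℝ ∞ fun w => Φ (inlL x + w) :=
    (Φ.smooth ⊤).comp (contDiff_const.add contDiff_id)
  rw [e, ContinuousLinearMap.iteratedFDeriv_comp_right _ hc _ (n := ((⊤ : ℕ∞) : ℕ∞ω)) (i := n) (mod_cast le_top),
    iteratedFDeriv_comp_add_left, ← pair_eq]
  refine (ContinuousMultilinearMap.norm_compContinuousLinearMap_le _ _).trans ?_
  refine mul_le_of_le_one_right (norm_nonneg _) ?_
  simp only [Finset.prod_const]
  exact pow_le_one₀ (norm_nonneg _) norm_inrL_le

theorem seminorm_slice_le (s : Finset (ℕ × ℕ)) (x : Rd d) (Φ : 𝓢(Rdd d, ℂ)) :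
    s.sup (schwartzSeminormFamily ℂ (Rd d) ℂ) (slice x Φ) ≤
      s.sup (schwartzSeminormFamily ℂ (Rdd d) ℂ) Φ := by
  refine Seminorm.finset_sup_apply_le (apply_nonneg _ _) fun i hi => ?_
  refine le_trans ?_ (Seminorm.le_finset_sup_apply hi)
  obtain ⟨k, n⟩ := i
  simp only [schwartzSeminormFamily_apply]
  refine SchwartzMap.seminorm_le_bound ℂ k n _ (apply_nonneg _ _) fun y => ?_
  refine le_trans ?_ (SchwartzMap.le_seminorm ℂ k n Φ (pair x y))
  gcongr
  · exact norm_snd_le_pair x y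
  · exact norm_iteratedFDeriv_slice_le x Φ n y

/-- Multiplication of a Schwartz function by the linear form `⟨m, ·⟩`. -/
def mulInner {V : Type} [NormedAddCommGroup V] [InnerProductSpace ℝ V] (m : V) :
    𝓢(V, ℂ) →L[ℂ] 𝓢(V, ℂ) :=
  SchwartzMap.smulLeftCLM ℂ fun z => ((inner ℝ m z : ℝ) : ℂ)

@[simp]
theorem mulInner_apply {V : Type} [NormedAddCommGroup V] [InnerProductSpace ℝ V] (m : V)
    (Φ : 𝓢(V, ℂ)) (z : V) : mulInner m Φ z = (inner ℝ m z : ℝ) * Φ z := by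
  have h : Function.HasTemperateGrowth fun z : V => ((inner ℝ m z : ℝ) : ℂ) :=
    (Complex.ofRealCLM.comp (innerSL ℝ m)).hasTemperateGrowth
  simp [mulInner, h]

theorem hasFDerivAt_apply_slice (g : 𝓢(Rd d, ℂ) →L[ℂ] ℂ) (Φ : 𝓢(Rdd d, ℂ)) (x : Rd d) :
    ∃ L : Rd d →L[ℝ] ℂ, HasFDerivAt (fun x => g (slice x Φ)) L x ∧
      ∀ m, L m = g (slice x (∂_{inlL m} Φ)) := by
  obtain ⟨L, hL, hLm⟩ := hasFDerivAt_translate (g.comp (slice x)) Φ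
  refine ⟨L.comp inlL, ?_, fun m => hLm _⟩
  have h1 : HasFDerivAt (fun x' : Rd d => inlL (x' - x)) (inlL : Rd d →L[ℝ] Rdd d) x :=
    inlL.hasFDerivAt.comp x ((hasFDerivAt_id x).sub_const x)
  have h2 : HasFDerivAt (fun a : Rdd d => (g.comp (slice x)) (Φ.compSubConstCLM ℂ (-a))) L
      (inlL (x - x)) := by simpa using hL
  refine (h2.comp x h1).congr_of_eventuallyEq (Filter.Eventually.of_forall fun x' => ?_)
  simp only [Function.comp_apply, ContinuousLinearMap.comp_apply]
  congr 1
  ext y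
  simp [pair_eq, add_comm]

/-- For a tempered distribution `g` on `ℝ^d` and a Schwartz function `Φ` on `ℝ^{2d}`, the Schwartz
function `x ↦ ⟨g, Φ_x⟩`. -/
def applySlice (g : 𝓢'(Rd d, ℂ)) : 𝓢(Rdd d, ℂ) →L[ℂ] 𝓢(Rd d, ℂ) :=
  mkIntertwining (fun Φ x => g (slice x Φ))
    (by
      obtain ⟨s, C, hC, h⟩ := exists_norm_le_sup_seminorm (V := Rd d) g
      exact ⟨s, C, hC, fun Φ x => (h _).trans (by gcongr; exact seminorm_slice_le s x Φ)⟩)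
    (fun Φ Ψ x => by simp only [map_add])
    (fun a Φ x => by simp only [map_smul])
    (fun m => LineDeriv.lineDerivOpCLM ℂ 𝓢(Rdd d, ℂ) (inlL m))
    (fun Φ x => hasFDerivAt_apply_slice g Φ x)
    (fun m => mulInner (inlL m))
    (fun m Φ x => by
      have : slice x (mulInner (inlL m) Φ) = ((inner ℝ m x : ℝ) : ℂ) • slice x Φ := by
        ext y
        have h1 : inlL m = pair m 0 := by simp [pair_eq]
        simp [h1, inner_eq_add, fstL_pair, sndL_pair]
      rw [this, map_smul, smul_eq_mul])

@[simp]
theorem applySlice_apply (g : 𝓢'(Rd d, ℂ)) (Φ : 𝓢(Rdd d, ℂ)) (x : Rd d) :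
    applySlice g Φ x = g (slice x Φ) := rfl

/-- The tensor product `f ⊗ g` of tempered distributions: `⟨f ⊗ g, Φ⟩ = ⟨f, x ↦ ⟨g, Φ_x⟩⟩`. -/
def tensor (f g : 𝓢'(Rd d, ℂ)) : 𝓢'(Rdd d, ℂ) :=
  PointwiseConvergenceCLM.precomp ℂ (applySlice g) f

end Slice

section PartialFourier

variable {d : ℕ}

open Complex in
theorem hasFDerivAt_fourier_slice (Φ : 𝓢(Rdd d, ℂ)) (z : Rdd d) :
    ∃ L : Rdd d →L[ℝ] ℂ, HasFDerivAt (fun z => 𝓕 (slice (fstL z) Φ) (sndL z)) L z ∧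
      ∀ m, L m = 𝓕 (slice (fstL z) (∂_{inlL (fstL m)} Φ -
        (2 * Real.pi * I) • mulInner (inrL (sndL m)) Φ)) (sndL z) := by
  let ℓ : Rd d → Rdd d →L[ℝ] ℂ := fun y =>
    (-(2 * Real.pi * I)) • (Complex.ofRealCLM.comp ((innerSL ℝ y).comp sndL))
  have hℓ : ∀ y w, ℓ y w = ((-2 * Real.pi * inner ℝ y (sndL w) : ℝ) : ℂ) * I := by
    intro y w
    simp [ℓ]; ring
  have hexp : ∀ y w, ‖cexp (ℓ y w)‖ = 1 := by
    intro y w; rw [hℓ, norm_exp_ofReal_mul_I]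
  have hF : ∀ (Ψ : 𝓢(Rdd d, ℂ)) w, 𝓕 (slice (fstL w) Ψ) (sndL w) =
      ∫ y, cexp (ℓ y w) * Ψ (pair (fstL w) y) := by
    intro Ψ w
    rw [SchwartzMap.fourier_coe, Real.fourier_eq']
    simp only [hℓ, smul_eq_mul, slice_apply]
  let F' : Rdd d → Rd d → Rdd d →L[ℝ] ℂ := fun w y =>
    cexp (ℓ y w) • ((fderiv ℝ Φ (pair (fstL w) y)).comp (inlL.comp fstL)) +
      Φ (pair (fstL w) y) • (cexp (ℓ y w) • ℓ y)
  have hdiff : ∀ w y, HasFDerivAt (fun w => cexp (ℓ y w) * Φ (pair (fstL w) y)) (F' w y) w := by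
    intro w y
    have h1 : HasFDerivAt (fun w => cexp (ℓ y w)) (cexp (ℓ y w) • ℓ y) w :=
      (ℓ y).hasFDerivAt.cexp
    have h2 : HasFDerivAt (fun w : Rdd d => Φ (pair (fstL w) y))
        ((fderiv ℝ Φ (pair (fstL w) y)).comp (inlL.comp fstL)) w := by
      refine HasFDerivAt.comp (g := Φ) (f := fun w : Rdd d => pair (fstL w) y) w
        (Φ.hasFDerivAt _) ?_
      simp only [pair_eq]
      exact ((inlL.comp fstL).hasFDerivAt).add_const _
    exact h1.mul h2
  have cont_pair : Continuous fun y : Rd d => pair (fstL z) y := by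
    simp only [pair_eq]; fun_prop
  have contℓ : Continuous ℓ := by
    simp only [ℓ]; fun_prop
  have contexp : ∀ w, Continuous fun y => cexp (ℓ y w) := by
    intro w; fun_prop
  have contfd : Continuous (fderiv ℝ Φ) := (SchwartzMap.fderivCLM ℝ (Rdd d) ℂ Φ).continuous
  have contF' : Continuous (F' z) := by
    have := contexp z
    have h3 : Continuous fun y : Rd d => fderiv ℝ Φ (pair (fstL z) y) := contfd.comp cont_pair
    have h4 : Continuous fun y : Rd d => Φ (pair (fstL z) y) := Φ.continuous.comp cont_pair
    simp only [F']
    exact (this.smul (h3.clm_comp continuous_const)).add (h4.smul (this.smul contℓ))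
  let N := (volume : Measure (Rd d)).integrablePower
  have hint := Measure.integrable_pow_neg_integrablePower (volume : Measure (Rd d))
  let S := 2 ^ (N + 1) * (Finset.Iic (N + 1, 1)).sup
    (fun m => SchwartzMap.seminorm ℂ m.1 m.2) Φ
  have hS : ∀ n ≤ 1, ∀ (w : Rdd d) (y : Rd d),
      (1 + ‖y‖) ^ (N + 1) * ‖iteratedFDeriv ℝ n Φ (pair (fstL w) y)‖ ≤ S := by
    intro n hn w y
    refine le_trans ?_ (SchwartzMap.one_add_le_sup_seminorm_apply (𝕜 := ℂ) (m := (N + 1, 1))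
      le_rfl hn Φ (pair (fstL w) y))
    gcongr
    exact norm_snd_le_pair _ _
  have hS0 : 0 ≤ S := by positivity
  let A := ‖(inlL.comp fstL : Rdd d →L[ℝ] Rdd d)‖
  let B := ‖(sndL : Rdd d →L[ℝ] Rd d)‖
  have hbound : ∀ y w, ‖F' w y‖ ≤ (S * A + S * (2 * Real.pi * B)) * (1 + ‖y‖) ^ (-(N : ℝ)) := by
    intro y w
    have hy : 0 < (1 + ‖y‖) ^ N := by positivity
    rw [Real.rpow_neg (by positivity), Real.rpow_natCast, ← div_eq_mul_inv, le_div_iff₀ hy]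
    have e0 := hS 0 zero_le_one w y
    have e1 := hS 1 le_rfl w y
    rw [norm_iteratedFDeriv_zero] at e0
    rw [norm_iteratedFDeriv_one] at e1
    have hℓn : ‖ℓ y‖ ≤ 2 * Real.pi * (‖y‖ * B) := by
      refine ContinuousLinearMap.opNorm_le_bound _ (by positivity) fun m => ?_
      rw [hℓ, norm_mul, norm_I, mul_one, Complex.norm_real, norm_mul, norm_mul, Real.norm_eq_abs,
        abs_neg, abs_two, Real.norm_eq_abs, abs_of_pos Real.pi_pos, mul_assoc (2 * Real.pi),
        mul_assoc ‖y‖]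
      refine mul_le_mul_of_nonneg_left ?_ (by positivity)
      exact (norm_inner_le_norm _ _).trans (by gcongr; exact sndL.le_opNorm m)
    have n1 : ‖F' w y‖ ≤ ‖fderiv ℝ Φ (pair (fstL w) y)‖ * A +
        ‖Φ (pair (fstL w) y)‖ * (2 * Real.pi * (‖y‖ * B)) := by
      refine (norm_add_le _ _).trans (add_le_add ?_ ?_)
      · rw [norm_smul, hexp, one_mul]
        exact ContinuousLinearMap.opNorm_comp_le _ _
      · rw [norm_smul, norm_smul, hexp, one_mul]
        gcongr
    have n2 : (1 + ‖y‖) ^ N ≤ (1 + ‖y‖) ^ (N + 1) :=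
      pow_le_pow_right₀ (by linarith [norm_nonneg y]) (Nat.le_succ N)
    have n3 : ‖y‖ * (1 + ‖y‖) ^ N ≤ (1 + ‖y‖) ^ (N + 1) := by
      rw [pow_succ']; gcongr; linarith
    calc ‖F' w y‖ * (1 + ‖y‖) ^ N
        ≤ (‖fderiv ℝ Φ (pair (fstL w) y)‖ * A +
          ‖Φ (pair (fstL w) y)‖ * (2 * Real.pi * (‖y‖ * B))) * (1 + ‖y‖) ^ N := by gcongr
      _ = ((1 + ‖y‖) ^ N * ‖fderiv ℝ Φ (pair (fstL w) y)‖) * A +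
          ((‖y‖ * (1 + ‖y‖) ^ N) * ‖Φ (pair (fstL w) y)‖) * (2 * Real.pi * B) := by ring
      _ ≤ ((1 + ‖y‖) ^ (N + 1) * ‖fderiv ℝ Φ (pair (fstL w) y)‖) * A +
          ((1 + ‖y‖) ^ (N + 1) * ‖Φ (pair (fstL w) y)‖) * (2 * Real.pi * B) := by gcongr
      _ ≤ S * A + S * (2 * Real.pi * B) := by gcongr
  have hint' : Integrable fun y : Rd d =>
      (S * A + S * (2 * Real.pi * B)) * (1 + ‖y‖) ^ (-(N : ℝ)) := hint.const_mul _
  have hF'int : Integrable (F' z) :=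
    hint'.mono' contF'.aestronglyMeasurable (Filter.Eventually.of_forall fun y => hbound y z)
  have hmeas : ∀ w, AEStronglyMeasurable (fun y => cexp (ℓ y w) * Φ (pair (fstL w) y))
      (volume : Measure (Rd d)) := by
    intro w
    exact ((contexp w).mul (slice (fstL w) Φ).continuous).aestronglyMeasurable
  have hFint : Integrable (fun y => cexp (ℓ y z) * Φ (pair (fstL z) y))
      (volume : Measure (Rd d)) := by
    refine (slice (fstL z) Φ).integrable.mono (hmeas z) (Filter.Eventually.of_forall fun y => ?_)
    simp [hexp]
  refine ⟨∫ y, F' z y, ?_, fun m => ?_⟩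
  · simp only [hF]
    exact hasFDerivAt_integral_of_dominated_of_fderiv_le Filter.univ_mem
      (Filter.Eventually.of_forall hmeas) hFint contF'.aestronglyMeasurable
      (Filter.Eventually.of_forall fun y w _ => hbound y w) hint'
      (Filter.Eventually.of_forall fun y w _ => hdiff w y)
  · rw [ContinuousLinearMap.integral_apply hF'int, hF]
    refine integral_congr_ae (Filter.Eventually.of_forall fun y => ?_)
    have h1 : inrL (sndL m) = pair 0 (sndL m) := by simp [pair_eq]
    simp [F', hℓ, SchwartzMap.lineDerivOp_apply_eq_fderiv, h1, inner_eq_add, fstL_pair, sndL_pair,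
      real_inner_comm y]
    ring

/-- The partial Fourier transform `ℱ₂Φ(x, ω) = ∫ e^{-2πi ω·y} Φ(x, y) dy` on `𝓢(ℝ^{2d})`, that is,
the Fourier transform of the section `Φ_x` evaluated at `ω`. -/
def partialFourierSchwartz : 𝓢(Rdd d, ℂ) →L[ℂ] 𝓢(Rdd d, ℂ) :=
  mkIntertwining (fun Φ z => 𝓕 (slice (fstL z) Φ) (sndL z))
    (by
      obtain ⟨s, C, hC, h⟩ := exists_sup_seminorm_comp_le
        (FourierTransform.fourierCLM ℂ 𝓢(Rd d, ℂ)) {(0, 0)}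
      refine ⟨s, C, hC, fun Φ z => ?_⟩
      refine (SchwartzMap.norm_le_seminorm ℂ _ _).trans ?_
      have h' := h (slice (fstL z) Φ)
      simp only [Finset.sup_singleton, schwartzSeminormFamily_apply,
        FourierTransform.fourierCLM_apply] at h'
      exact h'.trans (by gcongr; exact seminorm_slice_le s _ Φ))
    (fun Φ Ψ z => by simp only [map_add, FourierTransform.fourier_add, add_apply])
    (fun a Φ z => by simp only [map_smul, FourierTransform.fourier_smul, smul_apply])
    (fun m => LineDeriv.lineDerivOpCLM ℂ 𝓢(Rdd d, ℂ) (inlL (fstL m)) -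
      (2 * Real.pi * Complex.I) • mulInner (inrL (sndL m)))
    (fun Φ z => hasFDerivAt_fourier_slice Φ z)
    (fun m => mulInner (inlL (fstL m)) +
      (2 * Real.pi * Complex.I)⁻¹ • LineDeriv.lineDerivOpCLM ℂ 𝓢(Rdd d, ℂ) (inrL (sndL m)))
    (fun m Φ z => by
      have h1 : slice (fstL z) (mulInner (inlL (fstL m)) Φ) =
          ((inner ℝ (fstL m) (fstL z) : ℝ) : ℂ) • slice (fstL z) Φ := by
        ext y
        have h1 : inlL (fstL m) = pair (fstL m) 0 := by simp [pair_eq]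
        simp [h1, inner_eq_add, fstL_pair, sndL_pair]
      have h2 : slice (fstL z) (∂_{inrL (sndL m)} Φ) = ∂_{sndL m} (slice (fstL z) Φ) := by
        ext y
        rw [slice_apply, SchwartzMap.lineDerivOp_apply_eq_fderiv,
          SchwartzMap.lineDerivOp_apply_eq_fderiv]
        have h3 : HasFDerivAt (slice (fstL z) Φ)
            ((fderiv ℝ Φ (pair (fstL z) y)).comp inrL) y := by
          refine HasFDerivAt.comp (g := Φ) (f := fun y => pair (fstL z) y) y
            (Φ.hasFDerivAt _) ?_
          simp only [pair_eq]
          exact inrL.hasFDerivAt.const_add _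
        rw [h3.fderiv]
        rfl
      have h4 : Function.HasTemperateGrowth fun w : Rd d => inner ℝ w (sndL m) := by fun_prop
      simp only [add_apply, smul_apply, map_add, map_smul,
        FourierTransform.fourier_add, FourierTransform.fourier_smul, h1, LineDeriv.lineDerivOpCLM_apply, h2,
        SchwartzMap.fourier_lineDerivOp_eq, SchwartzMap.smulLeftCLM_apply_apply h4, smul_eq_mul]
      rw [inner_eq_add, real_inner_comm (sndL z)]
      have : (Real.pi : ℂ) ≠ 0 := by exact_mod_cast Real.pi_ne_zero
      rw [Complex.real_smul]
      push_cast
      field_simp)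

@[simp]
theorem partialFourierSchwartz_apply (Φ : 𝓢(Rdd d, ℂ)) (x w : Rd d) :
    partialFourierSchwartz Φ (pair x w) =
      ∫ y, Complex.exp (((-2 * Real.pi * inner ℝ y w : ℝ) : ℂ) * Complex.I) * Φ (pair x y) := by
  change 𝓕 (slice (fstL (pair x w)) Φ) (sndL (pair x w)) = _
  rw [SchwartzMap.fourier_coe, Real.fourier_eq', fstL_pair, sndL_pair]
  simp

/-- The partial Fourier transform `ℱ₂` on `𝓢'(ℝ^{2d})`, defined by duality. -/
def partialFourier : 𝓢'(Rdd d, ℂ) →L[ℂ] 𝓢'(Rdd d, ℂ) :=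
  PointwiseConvergenceCLM.precomp ℂ partialFourierSchwartz

end PartialFourier

section Operations

/-- The complex conjugate `conj φ` of a Schwartz function. -/
def conjS {V : Type} [NormedAddCommGroup V] [NormedSpace ℝ V] :
    𝓢(V, ℂ) →L[ℝ] 𝓢(V, ℂ) :=
  SchwartzMap.postcompCLM (Complex.conjCLE : ℂ →L[ℝ] ℂ)

@[simp]
theorem conjS_apply {V : Type} [NormedAddCommGroup V] [NormedSpace ℝ V] (φ : 𝓢(V, ℂ)) (x : V) :
    conjS φ x = starRingEnd ℂ (φ x) := rfl

/-- The complex conjugate of a tempered distribution: `⟨conj f, φ⟩ = conj ⟨f, conj φ⟩`. -/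
def conjD {V : Type} [NormedAddCommGroup V] [NormedSpace ℝ V] (f : 𝓢'(V, ℂ)) : 𝓢'(V, ℂ) :=
  ContinuousLinearMap.toPointwiseConvergenceCLM ℂ (RingHom.id ℂ) 𝓢(V, ℂ) ℂ
    { toFun := fun φ => starRingEnd ℂ (f (conjS φ))
      map_add' := fun φ ψ => by simp only [map_add]
      map_smul' := fun c φ => by
        have : conjS (c • φ) = starRingEnd ℂ c • conjS φ := by ext x; simp
        rw [this, map_smul]
        simp
      cont := Complex.continuous_conj.comp
        ((ContinuousLinearMap.continuous (f : 𝓢(V, ℂ) →L[ℂ] ℂ)).comp conjS.continuous) }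

variable {d : ℕ}

/-- The linear change of variables of `ℝ^{2d}` given by an invertible matrix. -/
def matEquiv (A : GL (Fin d ⊕ Fin d) ℝ) : Rdd d ≃L[ℝ] Rdd d :=
  LinearEquiv.toContinuousLinearEquiv <| LinearEquiv.ofLinearMap
    (Matrix.toEuclideanLin (A : Matrix (Fin d ⊕ Fin d) (Fin d ⊕ Fin d) ℝ))
    (Matrix.toEuclideanLin ((A⁻¹ : GL (Fin d ⊕ Fin d) ℝ) :
      Matrix (Fin d ⊕ Fin d) (Fin d ⊕ Fin d) ℝ))
    (by
      ext z i
      rw [LinearMap.comp_apply, Matrix.toLpLin_apply, Matrix.toLpLin_apply,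
        Matrix.mulVec_mulVec, ← Units.val_mul, mul_inv_cancel]
      simp)
    (by
      ext z i
      rw [LinearMap.comp_apply, Matrix.toLpLin_apply, Matrix.toLpLin_apply,
        Matrix.mulVec_mulVec, ← Units.val_mul, inv_mul_cancel]
      simp)

/-- The coordinate transformation `u ↦ u ∘ A` on `𝓢'(ℝ^{2d})` for an invertible matrix `A`:
`⟨u ∘ A, φ⟩ = |det A|⁻¹ ⟨u, φ ∘ A⁻¹⟩`. -/
def coordTrans (A : GL (Fin d ⊕ Fin d) ℝ) : 𝓢'(Rdd d, ℂ) →L[ℂ] 𝓢'(Rdd d, ℂ) :=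
  ((|(A : Matrix (Fin d ⊕ Fin d) (Fin d ⊕ Fin d) ℝ).det|⁻¹ : ℝ) : ℂ) •
    PointwiseConvergenceCLM.precomp ℂ
      (SchwartzMap.compCLMOfContinuousLinearEquiv ℂ (matEquiv A).symm)

/-- The canonical symplectic matrix `J = (0, I; -I, 0)`, so that `J (x, y) = (y, -x)`. -/
def symplecticJ (d : ℕ) : GL (Fin d ⊕ Fin d) ℝ where
  val := Matrix.fromBlocks 0 1 (-1) 0
  inv := Matrix.fromBlocks 0 (-1) 1 0
  val_inv := by simp [Matrix.fromBlocks_multiply]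
  inv_val := by simp [Matrix.fromBlocks_multiply]

/-- The symplectic Fourier transform `ℱ_σ u = (ℱ u) ∘ J` on `𝓢'(ℝ^{2d})`. -/
def symplecticFourier (u : 𝓢'(Rdd d, ℂ)) : 𝓢'(Rdd d, ℂ) := coordTrans (symplecticJ d) (𝓕 u)

end Operations

section MatrixWigner

variable {d : ℕ}

/-- The matrix-Wigner distribution `ℬ_A(f, g) = ℱ₂ 𝔗_A (f ⊗ conj g)` of tempered distributions. -/
def matrixWigner (A : GL (Fin d ⊕ Fin d) ℝ) (f g : 𝓢'(Rd d, ℂ)) : 𝓢'(Rdd d, ℂ) :=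
  partialFourier (coordTrans A (tensor f (conjD g)))

/-- The matrix `(I, (1/2)I; I, -(1/2)I)` of the Wigner distribution. -/
def wignerMatrix (d : ℕ) : GL (Fin d ⊕ Fin d) ℝ where
  val := Matrix.fromBlocks 1 ((1 / 2 : ℝ) • 1) 1 (-((1 / 2 : ℝ) • 1))
  inv := Matrix.fromBlocks ((1 / 2 : ℝ) • 1) ((1 / 2 : ℝ) • 1) 1 (-1)
  val_inv := by
    rw [Matrix.fromBlocks_multiply, ← Matrix.fromBlocks_one]
    congr 1 <;> simp [← add_smul] <;> norm_num
  inv_val := by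
    rw [Matrix.fromBlocks_multiply, ← Matrix.fromBlocks_one]
    congr 1 <;> simp [← add_smul] <;> norm_num

/-- The Cohen-type matrix `A_M = (I, M + (1/2)I; I, M - (1/2)I)`. -/
def cohenMatrix (M : Matrix (Fin d) (Fin d) ℝ) : GL (Fin d ⊕ Fin d) ℝ where
  val := Matrix.fromBlocks 1 (M + (1 / 2 : ℝ) • 1) 1 (M - (1 / 2 : ℝ) • 1)
  inv := Matrix.fromBlocks ((1 / 2 : ℝ) • 1 - M) (M + (1 / 2 : ℝ) • 1) 1 (-1)
  val_inv := by
    have h : (1 / 2 : ℝ) • (1 : Matrix (Fin d) (Fin d) ℝ) + (1 / 2 : ℝ) • 1 = 1 := by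
      rw [← add_smul]; norm_num
    rw [Matrix.fromBlocks_multiply, ← Matrix.fromBlocks_one]
    congr 1 <;> simp only [one_mul, mul_one, mul_neg] <;>
      generalize (1 / 2 : ℝ) • (1 : Matrix (Fin d) (Fin d) ℝ) = c at h ⊢
    · rw [← h]; abel
    · abel
    · abel
    · rw [← h]; abel
  inv_val := by
    have h : (1 / 2 : ℝ) • (1 : Matrix (Fin d) (Fin d) ℝ) + (1 / 2 : ℝ) • 1 = 1 := by
      rw [← add_smul]; norm_num
    rw [Matrix.fromBlocks_multiply, ← Matrix.fromBlocks_one]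
    congr 1
    · simp only [mul_one]
      generalize (1 / 2 : ℝ) • (1 : Matrix (Fin d) (Fin d) ℝ) = c at h ⊢
      rw [← h]; abel
    · simp only [add_mul, mul_add, sub_mul, mul_sub, smul_mul_assoc, mul_smul_comm, one_mul,
        mul_one]
      module
    · simp
    · simp only [one_mul, neg_mul]
      generalize (1 / 2 : ℝ) • (1 : Matrix (Fin d) (Fin d) ℝ) = c at h ⊢
      rw [← h]; abel

/-- The Wigner distribution `W f` of a tempered distribution. -/
def wigner (f : 𝓢'(Rd d, ℂ)) : 𝓢'(Rdd d, ℂ) := matrixWigner (wignerMatrix d) f f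

/-- The distribution `ℬ_{A_M} f` of a tempered distribution. -/
def perturbedWigner (M : Matrix (Fin d) (Fin d) ℝ) (f : 𝓢'(Rd d, ℂ)) : 𝓢'(Rdd d, ℂ) :=
  matrixWigner (cohenMatrix M) f f

end MatrixWigner

section Kernel

theorem hasTemperateGrowth_cexp_ofReal_mul_I :
    Function.HasTemperateGrowth fun t : ℝ => Complex.exp (t * Complex.I) := by
  have hd : ∀ t : ℝ, HasDerivAt (fun t : ℝ => Complex.exp (t * Complex.I))
      (Complex.I * Complex.exp (t * Complex.I)) t := by
    intro t
    have h := ((Complex.ofRealCLM.hasDerivAt (x := t)).mul_const Complex.I).cexp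
    simpa [mul_comm] using h
  have hi : ∀ n : ℕ, iteratedDeriv n (fun t : ℝ => Complex.exp (t * Complex.I)) =
      fun t : ℝ => Complex.I ^ n * Complex.exp (t * Complex.I) := by
    intro n
    induction n with
    | zero => simp
    | succ n ih =>
      rw [iteratedDeriv_succ, ih]
      ext t
      rw [((hd t).const_mul (Complex.I ^ n)).deriv]
      ring
  refine ⟨(Complex.ofRealCLM.contDiff.mul contDiff_const).cexp, fun n => ⟨0, 1, fun t => ?_⟩⟩
  rw [norm_iteratedFDeriv_eq_norm_iteratedDeriv, hi]
  simp [Complex.norm_exp_ofReal_mul_I]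

variable {d : ℕ}

/-- The chirp `χ_M(ξ, η) = e^{2πi η·Mξ}` on `ℝ^{2d}`. -/
def chirp (M : Matrix (Fin d) (Fin d) ℝ) (z : Rdd d) : ℂ :=
  Complex.exp (((2 * Real.pi * inner ℝ (sndL z) (Matrix.toEuclideanLin M (fstL z)) : ℝ) : ℂ) *
    Complex.I)

theorem hasTemperateGrowth_chirp (M : Matrix (Fin d) (Fin d) ℝ) :
    Function.HasTemperateGrowth (chirp M) := by
  have h : Function.HasTemperateGrowth fun z : Rdd d =>
      2 * Real.pi * (innerSL ℝ (sndL z) (LinearMap.toContinuousLinearMap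
        (Matrix.toEuclideanLin M) (fstL z)) : ℝ) := by
    refine (Function.HasTemperateGrowth.const _).mul ?_
    exact ContinuousLinearMap.bilinear_hasTemperateGrowth (𝕜 := ℝ) (innerSL ℝ)
      sndL.hasTemperateGrowth
      ((LinearMap.toContinuousLinearMap (Matrix.toEuclideanLin M)).comp fstL).hasTemperateGrowth
  exact hasTemperateGrowth_cexp_ofReal_mul_I.comp h

/-- The Cohen kernel `θ_M = ℱ_σ χ_M`. -/
def theta (M : Matrix (Fin d) (Fin d) ℝ) : 𝓢'(Rdd d, ℂ) :=
  symplecticFourier ((hasTemperateGrowth_chirp M).toTemperedDistribution volume)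

end Kernel

section FunctionSpaces

variable {V : Type} [NormedAddCommGroup V] [InnerProductSpace ℝ V]

/-- The time-frequency shift `π(x, ξ) g (t) = e^{2πi ξ·t} g(t - x)`. -/
def timeFreqShift (x ξ : V) (g : 𝓢(V, ℂ)) : 𝓢(V, ℂ) :=
  SchwartzMap.smulLeftCLM ℂ
    (fun t : V => Complex.exp (((2 * Real.pi * inner ℝ ξ t : ℝ) : ℂ) * Complex.I))
    (g.compSubConstCLM ℂ x)

@[simp]
theorem timeFreqShift_apply (x ξ : V) (g : 𝓢(V, ℂ)) (t : V) :
    timeFreqShift x ξ g t =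
      Complex.exp (((2 * Real.pi * inner ℝ ξ t : ℝ) : ℂ) * Complex.I) * g (t - x) := by
  have h : Function.HasTemperateGrowth fun t : V => 2 * Real.pi * (inner ℝ ξ t : ℝ) :=
    (Function.HasTemperateGrowth.const _).mul (innerSL ℝ ξ).hasTemperateGrowth
  have h' := hasTemperateGrowth_cexp_ofReal_mul_I.comp h
  exact SchwartzMap.smulLeftCLM_apply_apply h' _ _

/-- The short-time Fourier transform `V_g f(x, ξ) = ⟨f, π(x, ξ) g⟩` of a tempered distribution with
respect to the window `g`, where the bracket is conjugate-linear in the second entry. -/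
def stft (g : 𝓢(V, ℂ)) (f : 𝓢'(V, ℂ)) (x ξ : V) : ℂ := f (conjS (timeFreqShift x ξ g))

variable [FiniteDimensional ℝ V] [MeasurableSpace V] [BorelSpace V]

/-- The modulation space `M^{p,q}`, described with the window `g`: the tempered distributions `f`
for which the mixed norm `‖ ξ ↦ ‖V_g f(·, ξ)‖_{L^p} ‖_{L^q}` is finite. -/
def modulationSpace (g : 𝓢(V, ℂ)) (p q : ℝ≥0∞) : Set 𝓢'(V, ℂ) :=
  {f | eLpNorm (fun ξ : V => eLpNorm (fun x : V => stft g f x ξ) p volume) q volume < ⊤}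

/-- The Wiener amalgam space `W(ℱL^p, L^q)`, described with the window `g`: the tempered
distributions `f` for which the mixed norm `‖ x ↦ ‖V_g f(x, ·)‖_{L^p} ‖_{L^q}` is finite. -/
def wienerAmalgam (g : 𝓢(V, ℂ)) (p q : ℝ≥0∞) : Set 𝓢'(V, ℂ) :=
  {f | eLpNorm (fun x : V => eLpNorm (fun ξ : V => stft g f x ξ) p volume) q volume < ⊤}

end FunctionSpaces

end CohenClass

end

open CohenClass SchwartzMap
open scoped ENNReal

/-! Write `c = χ_M ∘ J`, that is `c(z₁, z₂) = e^{-2πi z₁·M z₂}` (`dualChirp M`), and let `T` be the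
Fourier multiplier with symbol `c`. Two identities reduce everything to `T`.

The matrix of `ℬ_{A_M}` is the Wigner matrix times the block matrix `(I, M; 0, I)`, so before `ℱ₂`
the two distributions differ by the substitution `x ↦ x + My`. On the Fourier side a translation in
`x` by `My` is a phase, and `y` is, up to sign, the frequency dual to `ω`. Hence `ℬ_{A_M} f = T(Wf)`
(`perturbedWigner_eq`). The kernel is `θ_M = T δ₀` (`theta_eq`), so formally `ℬ_{A_M} f = θ_M * Wf`,
but no convolution of distributions is needed.

The symbol is a unimodular character of second degree: `c(z + h) = c(z) c(h) e^{2πi Bh·z}` with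
`B(z₁, z₂) = (-M z₂, -Mᵀ z₁)`. Conjugating a time-frequency shift by the transpose of `T` therefore
gives another such shift, up to a phase, whence `|V_g(Tu)(x, ξ)| = |V_{g'} u(x + Bξ, ξ)|` for a new
nonzero window `g'` (`norm_stft_fourierMultiplier`).

For `M^{p,q}` the shear is a translation in `x` at each fixed `ξ`, invisible to the inner `L^p`
norm. So `Tu` has the norm of `u` measured with the window `g'`, and the equivalence follows once
`M^{p,q}` is known not to depend on the window. For `u = δ₀` the formula reads `|V_g θ_M(x, ξ)| =
|g'(-(x + Bξ))|` with `g'` Schwartz. Integration in `x` gives `‖g'‖₁` for every `ξ`; integration in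
`ξ` gives `|det B|⁻¹ ‖g'‖₁` for every `x`, and this is where the invertibility of `M` enters.

Window independence (`modulationSpace_eq`) takes up most of the proof. Reconstructing a tempered
distribution from its short-time Fourier transform bounds `|V_{g₁} u|` by `|V_g u|` convolved with a
rapidly decreasing kernel, and Minkowski's inequality then gives Young's inequality in the mixed
norm. The reconstruction requires applying a tempered distribution under an integral sign
(`apply_eq_integral`): the distribution is factored through finitely many Banach spaces of weighted
derivatives, where Bochner integration is available. -/

noncomputable section

open SchwartzMap MeasureTheory
open scoped ContDiff FourierTransform LineDeriv ENNReal

namespace CohenClass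

/-! ### Sections of Schwartz functions on a product, and Schwartz seminorms as Banach norms. -/

section Product

variable {V W : Type} [NormedAddCommGroup V] [NormedSpace ℝ V]
  [NormedAddCommGroup W] [NormedSpace ℝ W]

/-- The section `Φ(·, w)` of a Schwartz function on a product. -/
def sliceFst (w : W) : 𝓢(V × W, ℂ) →L[ℂ] 𝓢(V, ℂ) :=
  SchwartzMap.compCLMOfAntilipschitz ℂ (K := 1) (g := fun t => (t, w))
    (by
      have : (fun t : V => (t, w)) = fun t => ContinuousLinearMap.inl ℝ V W t + (0, w) := by
        ext t <;> simp
      rw [this]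
      fun_prop)
    (AntilipschitzWith.of_le_mul_dist fun t t' => by simp [Prod.dist_eq])

@[simp]
theorem sliceFst_apply (w : W) (Φ : 𝓢(V × W, ℂ)) (t : V) : sliceFst w Φ t = Φ (t, w) := rfl

theorem iteratedFDeriv_sliceFst (w : W) (Φ : 𝓢(V × W, ℂ)) (n : ℕ) (t : V) :
    iteratedFDeriv ℝ n (sliceFst w Φ) t =
      (iteratedFDeriv ℝ n Φ (t, w)).compContinuousLinearMap
        fun _ => ContinuousLinearMap.inl ℝ V W := by
  have e : ⇑(sliceFst w Φ) = (fun z => Φ ((0, w) + z)) ∘ ContinuousLinearMap.inl ℝ V W := by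
    ext t; simp
  have hc : ContDiff ℝ ∞ fun z => Φ ((0, w) + z) :=
    (Φ.smooth ⊤).comp (contDiff_const.add contDiff_id)
  rw [e, ContinuousLinearMap.iteratedFDeriv_comp_right _ hc _ (n := ((⊤ : ℕ∞) : ℕ∞ω)) (i := n)
    (mod_cast le_top), iteratedFDeriv_comp_add_left]
  simp

theorem norm_compContinuousLinearMap_inl_le {n : ℕ} (f : (V × W) [×n]→L[ℝ] ℂ) :
    ‖f.compContinuousLinearMap fun _ => ContinuousLinearMap.inl ℝ V W‖ ≤ ‖f‖ := by
  refine (ContinuousMultilinearMap.norm_compContinuousLinearMap_le _ _).trans ?_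
  refine mul_le_of_le_one_right (norm_nonneg _) ?_
  simp only [Finset.prod_const]
  exact pow_le_one₀ (norm_nonneg _) (ContinuousLinearMap.norm_inl_le_one ℝ V W)

/-- The Schwartz seminorms of the sections of a Schwartz function decay rapidly. -/
theorem exists_seminorm_sliceFst_le (s : Finset (ℕ × ℕ)) (N : ℕ) (Φ : 𝓢(V × W, ℂ)) :
    ∃ C : ℝ, 0 ≤ C ∧ ∀ w : W,
      (1 + ‖w‖) ^ N * s.sup (schwartzSeminormFamily ℂ V ℂ) (sliceFst w Φ) ≤ C := by
  have key : ∀ i : ℕ × ℕ, ∃ C : ℝ, 0 ≤ C ∧ ∀ w : W,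
      (1 + ‖w‖) ^ N * schwartzSeminormFamily ℂ V ℂ i (sliceFst w Φ) ≤ C := by
    rintro ⟨k, n⟩
    -- The weight `‖t‖ ^ k (1 + ‖w‖) ^ N` is at most `(1 + ‖(t, w)‖) ^ (k + N)`, so the decay of `Φ`
    -- of order `k + N` pays for both factors.
    refine ⟨2 ^ (k + N) * (Finset.Iic (k + N, n)).sup
      (fun m => SchwartzMap.seminorm ℂ m.1 m.2) Φ, by positivity, fun w => ?_⟩
    have hw : 0 < (1 + ‖w‖) ^ N := by positivity
    rw [mul_comm, ← le_div_iff₀ hw, schwartzSeminormFamily_apply]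
    refine SchwartzMap.seminorm_le_bound ℂ k n _ (by positivity) fun t => ?_
    rw [le_div_iff₀ hw]
    refine le_trans ?_ (SchwartzMap.one_add_le_sup_seminorm_apply (𝕜 := ℂ) (m := (k + N, n))
      le_rfl le_rfl Φ (t, w))
    have h1 : ‖iteratedFDeriv ℝ n (sliceFst w Φ) t‖ ≤ ‖iteratedFDeriv ℝ n Φ (t, w)‖ := by
      rw [iteratedFDeriv_sliceFst]; exact norm_compContinuousLinearMap_inl_le _
    have h2 : ‖t‖ ≤ 1 + ‖(t, w)‖ := (norm_fst_le (t, w)).trans (by linarith)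
    have h3 : 1 + ‖w‖ ≤ 1 + ‖(t, w)‖ := by simp
    calc ‖t‖ ^ k * ‖iteratedFDeriv ℝ n (sliceFst w Φ) t‖ * (1 + ‖w‖) ^ N
        ≤ (1 + ‖(t, w)‖) ^ k * ‖iteratedFDeriv ℝ n Φ (t, w)‖ * (1 + ‖(t, w)‖) ^ N := by gcongr
      _ = _ := by rw [pow_add]; ring
  choose C hC h using key
  refine ⟨∑ i ∈ s, C i, Finset.sum_nonneg fun i _ => hC i, fun w => ?_⟩
  have hw : 0 < (1 + ‖w‖) ^ N := by positivity
  rw [mul_comm, ← le_div_iff₀ hw]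
  refine Seminorm.finset_sup_apply_le
    (div_nonneg (Finset.sum_nonneg fun i _ => hC i) hw.le) fun i hi => ?_
  rw [le_div_iff₀ hw, mul_comm]
  exact (h i w).trans (Finset.single_le_sum (fun i _ => hC i) hi)

/-- Mean value inequality along the segment from `(t, w')` to `(t, w)`. Its first coordinate is
constantly `t`, so the weight `‖t‖ ^ k` can be divided out and then absorbed into the norm of the
moving point. -/
theorem seminorm_sliceFst_sub_le (k n : ℕ) (Φ : 𝓢(V × W, ℂ)) (w w' : W) :
    SchwartzMap.seminorm ℂ k n (sliceFst w Φ - sliceFst w' Φ) ≤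
      SchwartzMap.seminorm ℂ k (n + 1) Φ * ‖w - w'‖ := by
  refine SchwartzMap.seminorm_le_bound ℂ k n _ (by positivity) fun t => ?_
  have h1 : iteratedFDeriv ℝ n (sliceFst w Φ - sliceFst w' Φ) t =
      (iteratedFDeriv ℝ n Φ (t, w) - iteratedFDeriv ℝ n Φ (t, w')).compContinuousLinearMap
        fun _ => ContinuousLinearMap.inl ℝ V W := by
    have : ⇑(sliceFst w Φ - sliceFst w' Φ) = ⇑(sliceFst w Φ) - ⇑(sliceFst w' Φ) := by
      ext; simp
    rw [this, iteratedFDeriv_sub_apply ((sliceFst w Φ).smooth n).contDiffAt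
      ((sliceFst w' Φ).smooth n).contDiffAt, iteratedFDeriv_sliceFst, iteratedFDeriv_sliceFst]
    ext m; simp
  rw [h1]
  by_cases ht : ‖t‖ ^ k = 0
  · rw [ht, zero_mul]; positivity
  have ht' : 0 < ‖t‖ ^ k := lt_of_le_of_ne (by positivity) (Ne.symm ht)
  have hd : Differentiable ℝ (iteratedFDeriv ℝ n Φ) :=
    (Φ.smooth ⊤).differentiable_iteratedFDeriv (by exact_mod_cast ENat.natCast_lt_top n)
  have h2 : ‖iteratedFDeriv ℝ n Φ (t, w) - iteratedFDeriv ℝ n Φ (t, w')‖ ≤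
      SchwartzMap.seminorm ℂ k (n + 1) Φ / ‖t‖ ^ k * ‖(t, w) - (t, w')‖ := by
    refine (convex_segment (t, w') (t, w)).norm_image_sub_le_of_norm_fderiv_le (𝕜 := ℝ)
      (fun z _ => hd z) (fun z hz => ?_) (left_mem_segment ℝ _ _) (right_mem_segment ℝ _ _)
    rw [norm_fderiv_iteratedFDeriv, le_div_iff₀ ht', mul_comm]
    refine le_trans ?_ (SchwartzMap.le_seminorm ℂ k (n + 1) Φ z)
    have hz1 : z.1 = t := by
      obtain ⟨a, b, -, -, hab, rfl⟩ := hz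
      simp [← add_smul, hab]
    gcongr
    rw [← hz1]
    exact norm_fst_le z
  calc _ ≤ ‖t‖ ^ k * (SchwartzMap.seminorm ℂ k (n + 1) Φ / ‖t‖ ^ k * ‖(t, w) - (t, w')‖) := by
        gcongr
        exact (norm_compContinuousLinearMap_inl_le _).trans h2
    _ = _ := by
        rw [Prod.mk_sub_mk, sub_self, Prod.norm_mk, norm_zero, max_eq_right (norm_nonneg _)]
        field_simp

theorem lineDerivOp_sliceFst (w : W) (Φ : 𝓢(V × W, ℂ)) (m : V) :
    ∂_{m} (sliceFst w Φ) = sliceFst w (∂_{((m, 0) : V × W)} Φ) := by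
  ext t
  rw [sliceFst_apply, SchwartzMap.lineDerivOp_apply_eq_fderiv,
    SchwartzMap.lineDerivOp_apply_eq_fderiv]
  have h : HasFDerivAt (sliceFst w Φ)
      ((fderiv ℝ Φ (t, w)).comp (ContinuousLinearMap.inl ℝ V W)) t :=
    HasFDerivAt.comp (g := Φ) (f := fun t => (t, w)) t (Φ.hasFDerivAt _)
      (hasFDerivAt_prodMk_left t w)
  rw [h.fderiv]
  simp

/-- Bounded continuous functions with values in `n`-linear forms. -/
abbrev BoundedMultilinear (V : Type) [NormedAddCommGroup V] [NormedSpace ℝ V] (n : ℕ) : Type :=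
  @BoundedContinuousFunction V (V [×n]→L[ℝ] ℂ) _ SeminormedAddCommGroup.toPseudoMetricSpace

/-- The bounded function `t ↦ ‖t‖ ^ k D^n φ(t)`. -/
def weightedDeriv (k n : ℕ) : 𝓢(V, ℂ) →ₗ[ℂ] BoundedMultilinear V n where
  toFun φ := BoundedContinuousFunction.ofNormedAddCommGroup
    (fun t => (‖t‖ ^ k) • iteratedFDeriv ℝ n φ t)
    ((continuous_norm.pow k).smul ((φ.smooth n).continuous_iteratedFDeriv le_rfl))
    (SchwartzMap.seminorm ℂ k n φ)
    (fun t => by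
      rw [norm_smul, norm_pow, norm_norm]; exact SchwartzMap.le_seminorm ℂ k n φ t)
  map_add' φ ψ := by
    ext t m
    have : ⇑(φ + ψ) = ⇑φ + ⇑ψ := by ext; simp
    simp [this, iteratedFDeriv_add_apply (φ.smooth n).contDiffAt (ψ.smooth n).contDiffAt]
  map_smul' c φ := by
    ext t m
    have : ⇑(c • φ) = c • ⇑φ := by ext; simp
    simp [this, iteratedFDeriv_const_smul_apply (φ.smooth n).contDiffAt]
    ring

theorem weightedDeriv_apply (k n : ℕ) (φ : 𝓢(V, ℂ)) (t : V) :
    weightedDeriv k n φ t = (‖t‖ ^ k) • iteratedFDeriv ℝ n φ t := rfl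

/-- This turns a Schwartz seminorm into the norm of a Banach space of bounded functions, in which
Bochner integrals and Hahn–Banach can be used. -/
theorem norm_weightedDeriv (k n : ℕ) (φ : 𝓢(V, ℂ)) :
    ‖weightedDeriv k n φ‖ = SchwartzMap.seminorm ℂ k n φ := by
  refine le_antisymm ?_ ?_
  · refine (BoundedContinuousFunction.norm_le (apply_nonneg _ _)).2 fun t => ?_
    rw [weightedDeriv_apply, norm_smul, norm_pow, norm_norm]
    exact SchwartzMap.le_seminorm ℂ k n φ t
  · have h : 0 ≤ ‖weightedDeriv k n φ‖ := norm_nonneg _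
    refine SchwartzMap.seminorm_le_bound ℂ k n φ h fun t => ?_
    have := (weightedDeriv k n φ).norm_coe_le_norm t
    rwa [weightedDeriv_apply, norm_smul, norm_pow, norm_norm] at this

/-- A linear functional bounded by `‖j x‖` factors continuously through `j`. -/
theorem exists_clm_comp_eq {X E : Type} [AddCommGroup X] [Module ℂ X] [NormedAddCommGroup E]
    [NormedSpace ℂ E] (u : X →ₗ[ℂ] ℂ) (j : X →ₗ[ℂ] E) (C : ℝ) (hj : ∀ x, ‖u x‖ ≤ C * ‖j x‖) :
    ∃ F : E →L[ℂ] ℂ, ∀ x, u x = F (j x) := by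
  -- The bound forces `u` to vanish on `ker j`, so `u` descends to the range of `j`; there it is
  -- continuous, and Hahn–Banach extends it to all of `E`.
  have hker : u ∈ (LinearMap.ker j).dualAnnihilator := by
    rw [Submodule.mem_dualAnnihilator]
    intro x hx
    have := hj x
    rw [LinearMap.mem_ker.1 hx, norm_zero, mul_zero] at this
    exact norm_le_zero_iff.1 this
  rw [← LinearMap.range_dualMap_eq_dualAnnihilator_ker] at hker
  obtain ⟨f, rfl⟩ := hker
  let f₀ : LinearMap.range j →L[ℂ] ℂ := (f.comp (LinearMap.range j).subtype).mkContinuous C (by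
    rintro ⟨_, x, rfl⟩
    exact hj x)
  obtain ⟨F, hF, -⟩ := exists_extension_norm_eq (𝕜 := ℂ) (LinearMap.range j) f₀
  exact ⟨F, fun x => (hF ⟨j x, x, rfl⟩).symm⟩

end Product

/-! ### Applying a tempered distribution under the integral sign. -/

section Fubini

/-- A functional that is controlled by finitely many linear maps into Banach spaces commutes with
an integral as soon as these maps do. -/
theorem apply_eq_integral_of_norm_le {α X ι : Type} [MeasurableSpace α] {μ : Measure α}
    [AddCommGroup X] [Module ℂ X] [Fintype ι] {E : ι → Type} [∀ i, NormedAddCommGroup (E i)]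
    [∀ i, NormedSpace ℂ (E i)] [∀ i, CompleteSpace (E i)] (u : X →ₗ[ℂ] ℂ)
    (j : ∀ i, X →ₗ[ℂ] E i) (C : ℝ) (h : ∀ x B, 0 ≤ B → (∀ i, ‖j i x‖ ≤ B) → ‖u x‖ ≤ C * B)
    (Γ : α → X) (x : X) (hint : ∀ i, Integrable (fun a => j i (Γ a)) μ)
    (hx : ∀ i, j i x = ∫ a, j i (Γ a) ∂μ) : u x = ∫ a, u (Γ a) ∂μ := by
  -- The finitely many maps are bundled into one map to the product space. Its sup norm is the
  -- smallest admissible `B`, so `u` becomes a continuous functional there and passes through the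
  -- Bochner integral.
  obtain ⟨F, hF⟩ := exists_clm_comp_eq u (LinearMap.pi j) C fun x =>
    h x _ (norm_nonneg _) fun i => norm_le_pi_norm (LinearMap.pi j x) i
  have hG : Integrable (fun a => LinearMap.pi j (Γ a)) μ := Integrable.of_eval hint
  simp only [hF]
  rw [F.integral_comp_comm hG]
  congr 1
  ext i
  rw [LinearMap.pi_apply, hx i]
  exact ((ContinuousLinearMap.proj (R := ℂ) i).integral_comp_comm hG)

variable {V W : Type} [NormedAddCommGroup V] [NormedSpace ℝ V]
  [NormedAddCommGroup W] [InnerProductSpace ℝ W]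

theorem continuous_sliceFst_weightedDeriv (k n : ℕ) (Φ : 𝓢(V × W, ℂ)) :
    Continuous fun w => weightedDeriv k n (sliceFst w Φ) := by
  refine (LipschitzWith.of_dist_le_mul (K := (SchwartzMap.seminorm ℂ k (n + 1) Φ).toNNReal)
    fun w w' => ?_).continuous
  rw [dist_eq_norm, ← map_sub, norm_weightedDeriv, Real.coe_toNNReal _ (apply_nonneg _ _),
    dist_eq_norm]
  exact seminorm_sliceFst_sub_le k n Φ w w'

variable [FiniteDimensional ℝ W] [MeasurableSpace W] [BorelSpace W]

/-- The Schwartz seminorms of sections are dominated by an integrable function. -/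
theorem exists_integrable_seminorm_sliceFst_le (s : Finset (ℕ × ℕ)) (Φ : 𝓢(V × W, ℂ)) :
    ∃ b : W → ℝ, Integrable b ∧
      ∀ w, s.sup (schwartzSeminormFamily ℂ V ℂ) (sliceFst w Φ) ≤ b w := by
  let N := (volume : Measure W).integrablePower
  obtain ⟨C, -, h⟩ := exists_seminorm_sliceFst_le s N Φ
  refine ⟨fun w => C * (1 + ‖w‖) ^ (-(N : ℝ)),
    (Measure.integrable_pow_neg_integrablePower (volume : Measure W)).const_mul C, fun w => ?_⟩
  dsimp only
  have hw : 0 < (1 + ‖w‖) ^ N := by positivity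
  rw [Real.rpow_neg (by positivity), Real.rpow_natCast, ← div_eq_mul_inv, le_div_iff₀ hw, mul_comm]
  exact h w

theorem integrable_snd (Φ : 𝓢(V × W, ℂ)) (t : V) : Integrable fun w => Φ (t, w) := by
  obtain ⟨b, hb, h⟩ := exists_integrable_seminorm_sliceFst_le {(0, 0)} Φ
  refine hb.mono' (Φ.continuous.comp (by fun_prop)).aestronglyMeasurable
    (Filter.Eventually.of_forall fun w => ?_)
  refine le_trans ?_ (h w)
  rw [Finset.sup_singleton, schwartzSeminormFamily_apply, ← sliceFst_apply]
  exact SchwartzMap.norm_le_seminorm ℂ _ t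

/-- Differentiation under the integral, dominated by the sup norms of the sections of `∂_{(m, 0)}
Φ`. The conclusion has the shape of the hypothesis `h`, so it can be iterated. -/
theorem lineDerivOp_eq_integral (Φ : 𝓢(V × W, ℂ)) (φ : 𝓢(V, ℂ))
    (h : ∀ t, φ t = ∫ w, Φ (t, w)) (m t : V) :
    (∂_{m} φ) t = ∫ w, (∂_{((m, 0) : V × W)} Φ) (t, w) := by
  obtain ⟨b, hb, hle⟩ := exists_integrable_seminorm_sliceFst_le {(0, 0)} (∂_{((m, 0) : V × W)} Φ)
  rw [SchwartzMap.lineDerivOp_apply]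
  have hd : ∀ w (r : ℝ), HasDerivAt (fun r : ℝ => Φ (t + r • m, w))
      ((∂_{((m, 0) : V × W)} Φ) (t + r • m, w)) r := by
    intro w r
    rw [SchwartzMap.lineDerivOp_apply_eq_fderiv]
    have h1 : HasDerivAt (fun r : ℝ => ((t + r • m, w) : V × W)) (m, 0) r := by
      have := ((hasDerivAt_id r).smul_const m).const_add t
      simp only [id, one_smul] at this
      exact this.prodMk (hasDerivAt_const r w)
    exact (Φ.hasFDerivAt (t + r • m, w)).comp_hasDerivAt r h1
  have key := hasDerivAt_integral_of_dominated_loc_of_deriv_le (μ := (volume : Measure W))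
    (F := fun (r : ℝ) w => Φ (t + r • m, w))
    (F' := fun (r : ℝ) w => (∂_{((m, 0) : V × W)} Φ) (t + r • m, w)) (x₀ := 0) (s := Set.univ)
    (bound := b) Filter.univ_mem
    (Filter.Eventually.of_forall fun r => (integrable_snd Φ _).aestronglyMeasurable)
    (integrable_snd Φ _) (integrable_snd _ _).aestronglyMeasurable
    (Filter.Eventually.of_forall fun w r _ => by
      refine le_trans ?_ (hle w)
      rw [Finset.sup_singleton, schwartzSeminormFamily_apply, ← sliceFst_apply]
      exact SchwartzMap.norm_le_seminorm ℂ _ _)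
    hb (Filter.Eventually.of_forall fun w r _ => hd w r)
  have e := key.2.deriv
  simp only [zero_smul, add_zero] at e
  rw [← e, lineDeriv]
  simp only [h]

theorem iteratedFDeriv_eq_integral (n : ℕ) (m : Fin n → V) (Φ : 𝓢(V × W, ℂ)) (φ : 𝓢(V, ℂ))
    (h : ∀ t, φ t = ∫ w, Φ (t, w)) (t : V) :
    iteratedFDeriv ℝ n φ t m = ∫ w, iteratedFDeriv ℝ n (sliceFst w Φ) t m := by
  simp only [← SchwartzMap.iteratedLineDerivOp_eq_iteratedFDeriv]
  induction n generalizing Φ φ with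
  | zero => simpa using h t
  | succ n ih =>
    -- Peeling off the derivative that acts first replaces the pair `(Φ, φ)` by its derivatives,
    -- which is why both are generalized.
    simp only [LineDeriv.iteratedLineDerivOp_succ_right, lineDerivOp_sliceFst]
    exact ih _ _ _ fun t => lineDerivOp_eq_integral Φ φ h _ t

/-- A tempered distribution may be applied under the integral sign. -/
theorem apply_eq_integral (u : 𝓢'(V, ℂ)) (Φ : 𝓢(V × W, ℂ)) (φ : 𝓢(V, ℂ))
    (h : ∀ t, φ t = ∫ w, Φ (t, w)) : u φ = ∫ w, u (sliceFst w Φ) := by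
  obtain ⟨s, C, hC, hu⟩ := exists_norm_le_sup_seminorm (V := V) u
  obtain ⟨b, hb, hle⟩ := exists_integrable_seminorm_sliceFst_le s Φ
  have hG : ∀ i : s, Integrable fun w => weightedDeriv i.1.1 i.1.2 (sliceFst w Φ) := by
    intro i
    have hm : AEStronglyMeasurable (fun w => weightedDeriv i.1.1 i.1.2 (sliceFst w Φ))
        (volume : Measure W) := (continuous_sliceFst_weightedDeriv _ _ Φ).aestronglyMeasurable
    refine Integrable.mono' (β := BoundedMultilinear V i.1.2) hb hm
      (Filter.Eventually.of_forall fun w => ?_)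
    refine le_trans ?_ (hle w)
    rw [norm_weightedDeriv]
    exact Seminorm.le_finset_sup_apply (p := schwartzSeminormFamily ℂ V ℂ) i.2
  refine apply_eq_integral_of_norm_le (X := 𝓢(V, ℂ)) (E := fun i : s => BoundedMultilinear V i.1.2)
    ((u : 𝓢(V, ℂ) →L[ℂ] ℂ) : 𝓢(V, ℂ) →ₗ[ℂ] ℂ) (fun i => weightedDeriv i.1.1 i.1.2) C
    (fun ψ B hB hψ => (hu ψ).trans (mul_le_mul_of_nonneg_left
      (Seminorm.finset_sup_apply_le hB fun i hi => ?_) hC)) _ φ hG fun i => ?_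
  · have := hψ ⟨i, hi⟩
    rwa [norm_weightedDeriv] at this
  · ext t m
    -- Equality in the space of bounded functions is tested by evaluation at `t` and at the vectors
    -- `m`, a continuous functional that commutes with the Bochner integral.
    let L : BoundedMultilinear V i.1.2 →L[ℝ] ℂ :=
      (ContinuousMultilinearMap.apply ℝ (fun _ => V) ℂ m).comp
        (BoundedContinuousFunction.evalCLM ℝ t)
    have hL := ContinuousLinearMap.integral_comp_comm (E := BoundedMultilinear V i.1.2) L (hG i)
    refine Eq.trans ?_ hL
    change (‖t‖ ^ i.1.1) • iteratedFDeriv ℝ i.1.2 φ t m =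
      ∫ w, (‖t‖ ^ i.1.1) • iteratedFDeriv ℝ i.1.2 (sliceFst w Φ) t m
    rw [integral_smul, iteratedFDeriv_eq_integral _ m Φ φ h t]

end Fubini

/-! ### Tensor products of Schwartz functions and the shear of the short-time Fourier transform. -/

section Tensor

variable {V W : Type} [NormedAddCommGroup V] [NormedSpace ℝ V]
  [NormedAddCommGroup W] [NormedSpace ℝ W]

theorem norm_iteratedFDeriv_comp_fst_le (φ : 𝓢(V, ℂ)) (n : ℕ) (z : V × W) :
    ‖iteratedFDeriv ℝ n (fun z : V × W => φ z.1) z‖ ≤ ‖iteratedFDeriv ℝ n φ z.1‖ := by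
  have := ContinuousLinearMap.iteratedFDeriv_comp_right (ContinuousLinearMap.fst ℝ V W)
    (φ.smooth ⊤) z (i := n) (mod_cast le_top)
  change ‖iteratedFDeriv ℝ n (φ ∘ ContinuousLinearMap.fst ℝ V W) z‖ ≤ _
  rw [this]
  refine (ContinuousMultilinearMap.norm_compContinuousLinearMap_le _ _).trans ?_
  refine mul_le_of_le_one_right (norm_nonneg _) ?_
  simp only [Finset.prod_const]
  exact pow_le_one₀ (norm_nonneg _) (ContinuousLinearMap.norm_fst_le ℝ V W)

theorem norm_iteratedFDeriv_comp_snd_le (ψ : 𝓢(W, ℂ)) (n : ℕ) (z : V × W) :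
    ‖iteratedFDeriv ℝ n (fun z : V × W => ψ z.2) z‖ ≤ ‖iteratedFDeriv ℝ n ψ z.2‖ := by
  have := ContinuousLinearMap.iteratedFDeriv_comp_right (ContinuousLinearMap.snd ℝ V W)
    (ψ.smooth ⊤) z (i := n) (mod_cast le_top)
  change ‖iteratedFDeriv ℝ n (ψ ∘ ContinuousLinearMap.snd ℝ V W) z‖ ≤ _
  rw [this]
  refine (ContinuousMultilinearMap.norm_compContinuousLinearMap_le _ _).trans ?_
  refine mul_le_of_le_one_right (norm_nonneg _) ?_
  simp only [Finset.prod_const]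
  exact pow_le_one₀ (norm_nonneg _) (ContinuousLinearMap.norm_snd_le ℝ V W)

/-- The tensor product `(t, w) ↦ φ(t) ψ(w)` of Schwartz functions. -/
def tensorS (φ : 𝓢(V, ℂ)) (ψ : 𝓢(W, ℂ)) : 𝓢(V × W, ℂ) where
  toFun z := φ z.1 * ψ z.2
  smooth' := ((φ.smooth ⊤).comp contDiff_fst).mul ((ψ.smooth ⊤).comp contDiff_snd)
  decay' k n := by
    have hφ : ContDiff ℝ ∞ fun z : V × W => φ z.1 := (φ.smooth ⊤).comp contDiff_fst
    have hψ : ContDiff ℝ ∞ fun z : V × W => ψ z.2 := (ψ.smooth ⊤).comp contDiff_snd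
    let p := fun k n => SchwartzMap.seminorm ℂ k n φ
    let q := fun k n => SchwartzMap.seminorm ℂ k n ψ
    -- The Leibniz rule supplies the binomial sum. The norm of a product is a maximum, so `‖z‖ ^ k`
    -- splits into two powers, each charged to one factor.
    refine ⟨∑ i ∈ Finset.range (n + 1), (n.choose i : ℝ) *
      (p k i * q 0 (n - i) + p 0 i * q k (n - i)), fun z => ?_⟩
    refine (mul_le_mul_of_nonneg_left (norm_iteratedFDeriv_mul_le hφ hψ z
      (n := n) (mod_cast le_top)) (by positivity)).trans ?_
    rw [Finset.mul_sum]
    refine Finset.sum_le_sum fun i _ => ?_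
    rw [mul_assoc, mul_left_comm]
    refine mul_le_mul_of_nonneg_left ?_ (by positivity)
    have hz : ‖z‖ ^ k ≤ ‖z.1‖ ^ k + ‖z.2‖ ^ k := by
      rw [Prod.norm_def]
      rcases max_choice ‖z.1‖ ‖z.2‖ with h | h <;> rw [h] <;> simp
    have a1 := SchwartzMap.le_seminorm ℂ k i φ z.1
    have a2 := SchwartzMap.le_seminorm ℂ 0 i φ z.1
    have b1 := SchwartzMap.le_seminorm ℂ k (n - i) ψ z.2
    have b2 := SchwartzMap.le_seminorm ℂ 0 (n - i) ψ z.2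
    rw [pow_zero, one_mul] at a2 b2
    calc _ ≤ (‖z.1‖ ^ k + ‖z.2‖ ^ k) *
          (‖iteratedFDeriv ℝ i φ z.1‖ * ‖iteratedFDeriv ℝ (n - i) ψ z.2‖) := by
          gcongr
          · exact norm_iteratedFDeriv_comp_fst_le φ i z
          · exact norm_iteratedFDeriv_comp_snd_le ψ (n - i) z
      _ = (‖z.1‖ ^ k * ‖iteratedFDeriv ℝ i φ z.1‖) * ‖iteratedFDeriv ℝ (n - i) ψ z.2‖ +
          ‖iteratedFDeriv ℝ i φ z.1‖ * (‖z.2‖ ^ k * ‖iteratedFDeriv ℝ (n - i) ψ z.2‖) := by ring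
      _ ≤ _ := by gcongr

/-- The shear `(t, x) ↦ (t, t - x)`. -/
def shearEquiv : (V × V) ≃L[ℝ] (V × V) :=
  ContinuousLinearEquiv.equivOfInverse
    ((ContinuousLinearMap.fst ℝ V V).prod
      (ContinuousLinearMap.fst ℝ V V - ContinuousLinearMap.snd ℝ V V))
    ((ContinuousLinearMap.fst ℝ V V).prod
      (ContinuousLinearMap.fst ℝ V V - ContinuousLinearMap.snd ℝ V V))
    (fun z => by ext <;> simp) (fun z => by ext <;> simp)

/-- The Schwartz function `(t, x) ↦ φ(t) ρ(t - x)`. -/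
def mulTranslate (φ ρ : 𝓢(V, ℂ)) : 𝓢(V × V, ℂ) :=
  SchwartzMap.compCLMOfContinuousLinearEquiv ℂ shearEquiv (tensorS φ ρ)

@[simp]
theorem mulTranslate_apply (φ ρ : 𝓢(V, ℂ)) (t x : V) :
    mulTranslate φ ρ (t, x) = φ t * ρ (t - x) := rfl

end Tensor

/-! ### Reconstruction from the short-time Fourier transform and change of window. -/

section Window

variable {V : Type} [NormedAddCommGroup V] [InnerProductSpace ℝ V]

/-- The Schwartz function `(t, ξ) ↦ e^{2πi ξ·t} h(t) a(ξ)`. -/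
def modTensor (h a : 𝓢(V, ℂ)) : 𝓢(V × V, ℂ) :=
  SchwartzMap.smulLeftCLM ℂ
    (fun z : V × V => Complex.exp (((2 * Real.pi * inner ℝ z.2 z.1 : ℝ) : ℂ) * Complex.I))
    (tensorS h a)

@[simp]
theorem modTensor_apply (h a : 𝓢(V, ℂ)) (t ξ : V) :
    modTensor h a (t, ξ) =
      Complex.exp (((2 * Real.pi * inner ℝ ξ t : ℝ) : ℂ) * Complex.I) * (h t * a ξ) := by
  have h1 : Function.HasTemperateGrowth fun z : V × V =>
      2 * Real.pi * (innerSL ℝ z.2 z.1 : ℝ) := by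
    refine (Function.HasTemperateGrowth.const _).mul ?_
    exact ContinuousLinearMap.bilinear_hasTemperateGrowth (𝕜 := ℝ) (innerSL ℝ)
      (ContinuousLinearMap.snd ℝ V V).hasTemperateGrowth
      (ContinuousLinearMap.fst ℝ V V).hasTemperateGrowth
  exact SchwartzMap.smulLeftCLM_apply_apply (hasTemperateGrowth_cexp_ofReal_mul_I.comp h1) _ _

/-- The pointwise product of two Schwartz functions. -/
def mulS (φ ψ : 𝓢(V, ℂ)) : 𝓢(V, ℂ) := SchwartzMap.smulLeftCLM ℂ φ ψ

@[simp]
theorem mulS_apply (φ ψ : 𝓢(V, ℂ)) (t : V) : mulS φ ψ t = φ t * ψ t :=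
  SchwartzMap.smulLeftCLM_apply_apply φ.hasTemperateGrowth _ _

theorem conjS_timeFreqShift (x ξ : V) (g : 𝓢(V, ℂ)) :
    conjS (timeFreqShift x ξ g) = timeFreqShift x (-ξ) (conjS g) := by
  ext t
  simp [← Complex.exp_conj, map_ofNat (starRingEnd ℂ) 2]

theorem conjS_conjS (g : 𝓢(V, ℂ)) : conjS (conjS g) = g := by
  ext t; simp

theorem stft_eq (g : 𝓢(V, ℂ)) (u : 𝓢'(V, ℂ)) (x ξ : V) :
    stft g u x ξ = u (timeFreqShift x (-ξ) (conjS g)) := by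
  rw [stft, conjS_timeFreqShift]

variable [FiniteDimensional ℝ V] [MeasurableSpace V] [BorelSpace V]

/-- The translates of `ρ` form a continuous partition of unity: `φ(t) = ∫ φ(t) ρ(t - x) dx`. -/
theorem apply_eq_integral_mulTranslate (u : 𝓢'(V, ℂ)) (φ ρ : 𝓢(V, ℂ)) (hρ : ∫ x, ρ x = 1) :
    u φ = ∫ x, u (sliceFst x (mulTranslate φ ρ)) := by
  refine apply_eq_integral u _ φ fun t => ?_
  simp only [mulTranslate_apply]
  rw [integral_const_mul, integral_sub_left_eq_self ρ, hρ, mul_one]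

/-- Fourier inversion writes `ψ h` as a superposition of modulations of `h` with weights `𝓕 ψ`. -/
theorem apply_mulS_eq_integral (u : 𝓢'(V, ℂ)) (ψ h : 𝓢(V, ℂ)) :
    u (mulS ψ h) = ∫ ξ, 𝓕 ψ ξ * u (timeFreqShift 0 ξ h) := by
  have key := apply_eq_integral u (modTensor h (𝓕 ψ)) (mulS ψ h) fun t => by
    have h1 : 𝓕⁻ (𝓕 ψ) t = ψ t := by rw [FourierTransform.fourierInv_fourier_eq]
    rw [mulS_apply, ← h1, SchwartzMap.fourierInv_coe, Real.fourierInv_eq', ← integral_mul_const]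
    refine integral_congr_ae (Filter.Eventually.of_forall fun ξ => ?_)
    simp only [modTensor_apply, smul_eq_mul]
    ring
  rw [key]
  refine integral_congr_ae (Filter.Eventually.of_forall fun ξ => ?_)
  have : sliceFst ξ (modTensor h (𝓕 ψ)) = 𝓕 ψ ξ • timeFreqShift 0 ξ h := by
    ext t
    simp
    ring
  simp only [this, map_smul, smul_eq_mul]

/-- Reconstruction of a tempered distribution from its short-time Fourier transform. -/
theorem apply_eq_integral_timeFreqShift (u : 𝓢'(V, ℂ)) (φ γ b : 𝓢(V, ℂ))
    (h : ∫ t, γ t * b t = 1) :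
    u φ = ∫ x, ∫ ξ, 𝓕 (sliceFst x (mulTranslate φ γ)) ξ * u (timeFreqShift x ξ b) := by
  rw [apply_eq_integral_mulTranslate u φ (mulS γ b) (by simpa using h)]
  refine integral_congr_ae (Filter.Eventually.of_forall fun x => ?_)
  have h1 : sliceFst x (mulTranslate φ (mulS γ b)) =
      mulS (sliceFst x (mulTranslate φ γ)) (b.compSubConstCLM ℂ x) := by
    ext t; simp [mul_assoc]
  have h2 : ∀ ξ, timeFreqShift 0 ξ (b.compSubConstCLM ℂ x) = timeFreqShift x ξ b := by
    intro ξ; ext t; simp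
  simp only [h1, apply_mulS_eq_integral, h2]

/-- Covariance of the short-time Fourier transform: shifting the function by `(x₀, ξ₀)` translates
the transform by `(x₀, ξ₀)` up to a phase. This makes the change-of-window bound a convolution. -/
theorem norm_fourier_slice_timeFreqShift (x₀ ξ₀ x ξ : V) (b γ : 𝓢(V, ℂ)) :
    ‖𝓕 (sliceFst x (mulTranslate (timeFreqShift x₀ ξ₀ b) γ)) ξ‖ =
      ‖𝓕 (sliceFst (x - x₀) (mulTranslate b γ)) (ξ - ξ₀)‖ := by
  have e : 𝓕 (sliceFst x (mulTranslate (timeFreqShift x₀ ξ₀ b) γ)) ξ =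
      Complex.exp (((-2 * Real.pi * inner ℝ x₀ (ξ - ξ₀) : ℝ) : ℂ) * Complex.I) *
        𝓕 (sliceFst (x - x₀) (mulTranslate b γ)) (ξ - ξ₀) := by
    rw [SchwartzMap.fourier_coe, SchwartzMap.fourier_coe, Real.fourier_eq', Real.fourier_eq',
      ← integral_const_mul]
    conv_rhs => rw [← integral_sub_right_eq_self _ x₀]
    refine integral_congr_ae (Filter.Eventually.of_forall fun t => ?_)
    simp only [sliceFst_apply, mulTranslate_apply, timeFreqShift_apply, smul_eq_mul,
      sub_sub_sub_cancel_right]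
    rw [← mul_assoc, ← mul_assoc, ← mul_assoc, ← mul_assoc, ← Complex.exp_add, ← Complex.exp_add]
    congr 3
    simp only [inner_sub_left, inner_sub_right, real_inner_comm t ξ₀]
    push_cast
    ring
  rw [e, norm_mul, Complex.norm_exp_ofReal_mul_I, one_mul]

/-- Rapid decay of the short-time Fourier transform of a Schwartz function. -/
theorem exists_lintegral_lt_top_fourier_slice_le (Φ : 𝓢(V × V, ℂ)) :
    ∃ a : V → ℝ≥0∞, Measurable a ∧ ∫⁻ x, a x < ⊤ ∧
      ∀ x ξ, ‖𝓕 (sliceFst x Φ) ξ‖ₑ ≤ a x * a ξ := by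
  let N := (volume : Measure V).integrablePower
  obtain ⟨s, C, hC, h⟩ := exists_sup_seminorm_comp_le
    (FourierTransform.fourierCLM ℂ 𝓢(V, ℂ)) (Finset.Iic (N, 0))
  obtain ⟨C', hC', h'⟩ := exists_seminorm_sliceFst_le s N Φ
  have key : ∀ x ξ, ‖𝓕 (sliceFst x Φ) ξ‖ ≤
      (2 ^ N * (C * C') + 1) * (1 + ‖x‖) ^ (-(N : ℝ)) * (1 + ‖ξ‖) ^ (-(N : ℝ)) := by
    intro x ξ
    have hx : 0 < (1 + ‖x‖) ^ N := by positivity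
    have hξ : 0 < (1 + ‖ξ‖) ^ N := by positivity
    have h1 := SchwartzMap.one_add_le_sup_seminorm_apply (𝕜 := ℂ) (m := (N, 0))
      le_rfl le_rfl (𝓕 (sliceFst x Φ)) ξ
    rw [norm_iteratedFDeriv_zero] at h1
    have h2 := h (sliceFst x Φ)
    rw [FourierTransform.fourierCLM_apply] at h2
    have h3 := h' x
    rw [Real.rpow_neg (by positivity), Real.rpow_neg (by positivity), Real.rpow_natCast,
      Real.rpow_natCast, ← div_eq_mul_inv, ← div_eq_mul_inv, le_div_iff₀ hξ, le_div_iff₀ hx]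
    calc _ = (1 + ‖x‖) ^ N * ((1 + ‖ξ‖) ^ N * ‖𝓕 (sliceFst x Φ) ξ‖) := by ring
      _ ≤ (1 + ‖x‖) ^ N * (2 ^ N * (C * s.sup (schwartzSeminormFamily ℂ V ℂ) (sliceFst x Φ))) := by
        refine mul_le_mul_of_nonneg_left (h1.trans ?_) hx.le
        exact mul_le_mul_of_nonneg_left h2 (by positivity)
      _ = 2 ^ N * (C * ((1 + ‖x‖) ^ N * s.sup (schwartzSeminormFamily ℂ V ℂ) (sliceFst x Φ))) := by
        ring
      _ ≤ 2 ^ N * (C * C') + 1 := by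
        refine le_trans ?_ (le_add_of_nonneg_right zero_le_one)
        gcongr
  -- The added `1` gives `K ≤ K * K`, so one function `a` carrying the factor `K` can serve both
  -- variables.
  have hK : 1 ≤ 2 ^ N * (C * C') + 1 := le_add_of_nonneg_left (by positivity)
  set K := 2 ^ N * (C * C') + 1
  have hint := (Measure.integrable_pow_neg_integrablePower (volume : Measure V)).const_mul K
  refine ⟨fun x => ENNReal.ofReal (K * (1 + ‖x‖) ^ (-(N : ℝ))), by fun_prop, ?_, fun x ξ => ?_⟩
  · exact hint.lintegral_lt_top
  · rw [← ENNReal.ofReal_mul (by positivity), ← ofReal_norm]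
    refine ENNReal.ofReal_le_ofReal ((key x ξ).trans ?_)
    rw [← mul_assoc]
    refine mul_le_mul_of_nonneg_right ?_ (by positivity)
    rw [mul_right_comm]
    exact mul_le_mul_of_nonneg_right
      (le_mul_of_one_le_right (zero_le_one.trans hK) hK) (by positivity)

theorem exists_integral_mul_conjS_eq_one (g : 𝓢(V, ℂ)) (hg : g ≠ 0) :
    ∃ γ : 𝓢(V, ℂ), ∫ t, γ t * conjS g t = 1 := by
  have h1 : ∫ t, g t * conjS g t = ((∫ t, ‖g t‖ ^ 2 : ℝ) : ℂ) := by
    rw [← integral_complex_ofReal]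
    refine integral_congr_ae (Filter.Eventually.of_forall fun t => ?_)
    simp [Complex.mul_conj, Complex.normSq_eq_norm_sq]
  have hne : (∫ t, ‖g t‖ ^ 2) ≠ 0 := by
    have hc : Continuous fun t => ‖g t‖ ^ 2 := g.continuous.norm.pow 2
    have hi : Integrable fun t => ‖g t‖ ^ 2 := by
      have := (mulS g (conjS g)).integrable (μ := volume).norm
      refine this.congr (Filter.Eventually.of_forall fun t => ?_)
      simp [sq]
    rw [Ne, integral_eq_zero_iff_of_nonneg (fun t => by positivity) hi]
    intro h0
    have h2 := (hc.ae_eq_iff_eq volume continuous_zero).1 h0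
    refine hg (SchwartzMap.ext fun t => ?_)
    simpa using congrFun h2 t
  refine ⟨((∫ t, ‖g t‖ ^ 2 : ℝ) : ℂ)⁻¹ • g, ?_⟩
  simp only [smul_apply, smul_eq_mul, mul_assoc]
  rw [integral_const_mul, h1, inv_mul_cancel₀ (by exact_mod_cast hne)]

/-- Change of window: the short-time Fourier transform with respect to another window is dominated
by a convolution with an integrable kernel. -/
theorem exists_enorm_stft_le (g g₁ : 𝓢(V, ℂ)) (hg : g ≠ 0) :
    ∃ a : V → ℝ≥0∞, Measurable a ∧ ∫⁻ x, a x < ⊤ ∧ ∀ (u : 𝓢'(V, ℂ)) x ξ,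
      ‖stft g₁ u x ξ‖ₑ ≤ ∫⁻ y, ∫⁻ η, a y * a η * ‖stft g u (x + y) (ξ - η)‖ₑ := by
  obtain ⟨γ, hγ⟩ := exists_integral_mul_conjS_eq_one g hg
  obtain ⟨a, ha, hai, hle⟩ :=
    exists_lintegral_lt_top_fourier_slice_le (mulTranslate (conjS g₁) γ)
  refine ⟨a, ha, hai, fun u x ξ => ?_⟩
  rw [stft_eq, apply_eq_integral_timeFreqShift u _ γ (conjS g) hγ]
  refine (enorm_integral_le_lintegral_enorm _).trans ?_
  -- Recentring the integration at `x`, and below at `-ξ`, turns the weight into one that depends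
  -- only on `(y, η)`.
  rw [← lintegral_add_left_eq_self _ x]
  refine lintegral_mono fun y => (enorm_integral_le_lintegral_enorm _).trans ?_
  rw [← lintegral_add_left_eq_self _ (-ξ)]
  refine lintegral_mono fun η => ?_
  dsimp only
  rw [enorm_mul, stft_eq, neg_sub, neg_add_eq_sub]
  refine mul_le_mul_left ?_ _
  refine le_trans (le_of_eq ?_) (hle y η)
  rw [← ofReal_norm, ← ofReal_norm, norm_fourier_slice_timeFreqShift]
  congr 4 <;> abel_nf

end Window

/-! ### Minkowski's integral inequality for functions with values in `[0, ∞]`. -/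

section Minkowski

variable {α β : Type} [MeasurableSpace α] [MeasurableSpace β] {μ : Measure α} {ν : Measure β}

theorem eLpNorm_eq_lintegral_rpow {p : ℝ≥0∞} (hp : 1 ≤ p) (hp' : p ≠ ⊤) (f : α → ℝ≥0∞) :
    eLpNorm f p μ = (∫⁻ x, f x ^ p.toReal ∂μ) ^ (1 / p.toReal) := by
  rw [eLpNorm_eq_lintegral_rpow_enorm_toReal (one_pos.trans_le hp).ne' hp']
  simp

theorem eLpNorm_const_mul_of_measurable {p : ℝ≥0∞} (hp : 1 ≤ p) (c : ℝ≥0∞) {f : α → ℝ≥0∞}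
    (hf : Measurable f) : eLpNorm (fun x => c * f x) p μ = c * eLpNorm f p μ := by
  by_cases hp' : p = ⊤
  · subst hp'
    simp only [eLpNorm_exponent_top, eLpNormEssSup, enorm_eq_self]
    exact ENNReal.essSup_const_mul
  have h0 : 0 < p.toReal := ENNReal.toReal_pos (one_pos.trans_le hp).ne' hp'
  simp only [eLpNorm_eq_lintegral_rpow hp hp', ENNReal.mul_rpow_of_nonneg _ _ h0.le]
  rw [lintegral_const_mul _ (hf.pow_const _), ENNReal.mul_rpow_of_nonneg _ _ (by positivity),
    ← ENNReal.rpow_mul, mul_one_div_cancel h0.ne', ENNReal.rpow_one]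

variable [SFinite μ] [SFinite ν]

theorem measurable_lintegral_rpow_left (F : α → β → ℝ≥0∞)
    (hF : Measurable (Function.uncurry F)) (p : ℝ) :
    Measurable fun y => (∫⁻ x, F x y ^ p ∂μ) ^ (1 / p) := by
  have : Measurable fun z : α × β => F z.1 z.2 ^ p := hF.pow_const p
  exact (Measurable.lintegral_prod_left' this).pow_const _

/-- **Minkowski's integral inequality**. -/
theorem lintegral_rpow_lintegral_le (F : α → β → ℝ≥0∞) (hF : Measurable (Function.uncurry F))
    (p : ℝ) (hp : 1 ≤ p) :
    (∫⁻ x, (∫⁻ y, F x y ∂ν) ^ p ∂μ) ^ (1 / p) ≤ ∫⁻ y, (∫⁻ x, F x y ^ p ∂μ) ^ (1 / p) ∂ν := by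
  rcases hp.eq_or_lt with rfl | hp
  · simp only [ENNReal.rpow_one, one_div, inv_one]
    exact (lintegral_lintegral_swap hF.aemeasurable).le
  have hp0 : 0 < p := one_pos.trans hp
  set N : β → ℝ≥0∞ := fun y => (∫⁻ x, F x y ^ p ∂μ) ^ (1 / p) with hN
  have hNm : Measurable N := measurable_lintegral_rpow_left F hF p
  by_cases htop : ∫⁻ y, N y ∂ν = ⊤
  · rw [htop]; exact le_top
  have hNtop : ∀ᵐ y ∂ν, N y < ⊤ := ae_lt_top hNm htop
  have hNp : ∀ y, N y ^ p = ∫⁻ x, F x y ^ p ∂μ := fun y => by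
    rw [hN, ← ENNReal.rpow_mul, one_div_mul_cancel hp0.ne', ENNReal.rpow_one]
  -- Negative powers of `N` appear below. Where `N y = 0` the function `F · y` vanishes almost
  -- everywhere, and Fubini exchanges the two quantifiers, so these `y` contribute nothing.
  have hzero : ∀ᵐ x ∂μ, ∀ᵐ y ∂ν, N y = 0 → F x y = 0 := by
    have hset : MeasurableSet {z : α × β | N z.2 = 0 → F z.1 z.2 = 0} := by
      have h1 : MeasurableSet {z : α × β | N z.2 = 0} :=
        (hNm.comp measurable_snd) (measurableSet_singleton 0)
      have h2 : MeasurableSet {z : α × β | F z.1 z.2 = 0} := hF (measurableSet_singleton 0)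
      exact h1.imp h2
    rw [Measure.ae_ae_comm hset]
    refine Filter.Eventually.of_forall fun y => ?_
    by_cases hy : N y = 0
    · have h0 : ∫⁻ x, F x y ^ p ∂μ = 0 := by rw [← hNp, hy, ENNReal.zero_rpow_of_pos hp0]
      have hm : Measurable fun x => F x y ^ p := (hF.comp measurable_prodMk_right).pow_const p
      rw [lintegral_eq_zero_iff hm] at h0
      filter_upwards [h0] with x hx _
      exact (ENNReal.rpow_eq_zero_iff_of_pos hp0).1 hx
    · exact Filter.Eventually.of_forall fun x h => absurd h hy
  obtain ⟨q, hpq⟩ : ∃ q : ℝ, p.HolderConjugate q := ⟨_, Real.HolderConjugate.conjExponent hp⟩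
  have hq0 : 0 < q := hpq.symm.pos
  -- Hölder applied to `F = N^{1/q} · (N^{-1/q} F)`. After integration in `x` the weight recombines
  -- as `N^{-p/q} N^p = N`, since `p - p/q = 1`.
  have hpoint : ∀ᵐ x ∂μ, (∫⁻ y, F x y ∂ν) ^ p ≤
      (∫⁻ y, N y ∂ν) ^ (p / q) * ∫⁻ y, N y ^ (-(p / q)) * F x y ^ p ∂ν := by
    filter_upwards [hzero] with x hx
    have hFx : Measurable fun y => F x y := hF.comp measurable_prodMk_left
    have e : ∫⁻ y, F x y ∂ν =
        ∫⁻ y, ((fun y => N y ^ (1 / q)) * fun y => N y ^ (-(1 / q)) * F x y) y ∂ν := by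
      refine lintegral_congr_ae ?_
      filter_upwards [hx, hNtop] with y hy hy'
      by_cases h0 : N y = 0
      · simp [hy h0]
      · rw [Pi.mul_apply, ← mul_assoc, ← ENNReal.rpow_add _ _ h0 hy'.ne, add_neg_cancel,
          ENNReal.rpow_zero, one_mul]
    rw [e]
    refine (ENNReal.rpow_le_rpow (ENNReal.lintegral_mul_le_Lp_mul_Lq ν hpq.symm
      (hNm.pow_const _).aemeasurable ((hNm.pow_const _).mul hFx).aemeasurable) hp0.le).trans ?_
    rw [ENNReal.mul_rpow_of_nonneg _ _ hp0.le, ← ENNReal.rpow_mul, ← ENNReal.rpow_mul,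
      one_div_mul_cancel hp0.ne', ENNReal.rpow_one]
    refine le_of_eq ?_
    congr 1
    · rw [one_div_mul_eq_div]
      congr 1
      refine lintegral_congr fun y => ?_
      rw [← ENNReal.rpow_mul, one_div_mul_cancel hq0.ne', ENNReal.rpow_one]
    · refine lintegral_congr fun y => ?_
      rw [Pi.mul_apply, ENNReal.mul_rpow_of_nonneg _ _ hp0.le, ← ENNReal.rpow_mul, neg_mul,
        one_div_mul_eq_div]
  have hmeas : Measurable fun z : α × β => N z.2 ^ (-(p / q)) * F z.1 z.2 ^ p :=
    ((hNm.comp measurable_snd).pow_const _).mul (hF.pow_const p)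
  have hsum : p / q + 1 = p := by
    have := hpq.inv_add_inv_eq_one
    field_simp at this ⊢
    linarith
  have hfinal : ∫⁻ x, (∫⁻ y, F x y ∂ν) ^ p ∂μ ≤ (∫⁻ y, N y ∂ν) ^ p := by
    calc _ ≤ ∫⁻ x, (∫⁻ y, N y ∂ν) ^ (p / q) * ∫⁻ y, N y ^ (-(p / q)) * F x y ^ p ∂ν ∂μ :=
          lintegral_mono_ae hpoint
      _ = (∫⁻ y, N y ∂ν) ^ (p / q) * ∫⁻ x, ∫⁻ y, N y ^ (-(p / q)) * F x y ^ p ∂ν ∂μ :=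
          lintegral_const_mul _ (Measurable.lintegral_prod_right' hmeas)
      _ = (∫⁻ y, N y ∂ν) ^ (p / q) * ∫⁻ y, N y ^ (-(p / q)) * N y ^ p ∂ν := by
          rw [lintegral_lintegral_swap hmeas.aemeasurable]
          congr 1
          refine lintegral_congr fun y => ?_
          have hm : Measurable fun x => F x y ^ p := (hF.comp measurable_prodMk_right).pow_const p
          rw [lintegral_const_mul _ hm, hNp]
      _ ≤ (∫⁻ y, N y ∂ν) ^ (p / q) * ∫⁻ y, N y ∂ν := by
          refine mul_le_mul_right (lintegral_mono_ae ?_) _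
          filter_upwards [hNtop] with y hy
          by_cases h0 : N y = 0
          · rw [h0, ENNReal.zero_rpow_of_pos hp0, mul_zero]
          · rw [← ENNReal.rpow_add _ _ h0 hy.ne]
            have : -(p / q) + p = 1 := by linarith
            rw [this, ENNReal.rpow_one]
      _ = (∫⁻ y, N y ∂ν) ^ p := by
          conv_rhs => rw [← hsum]
          rw [ENNReal.rpow_add_of_nonneg _ _ (div_nonneg hp0.le hq0.le) zero_le_one,
            ENNReal.rpow_one]
  refine (ENNReal.rpow_le_rpow hfinal (by positivity)).trans (le_of_eq ?_)
  rw [← ENNReal.rpow_mul, mul_one_div_cancel hp0.ne', ENNReal.rpow_one]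

theorem eLpNorm_lintegral_le {p : ℝ≥0∞} (hp : 1 ≤ p) (hp' : p ≠ ⊤) (F : α → β → ℝ≥0∞)
    (hF : Measurable (Function.uncurry F)) :
    eLpNorm (fun x => ∫⁻ y, F x y ∂ν) p μ ≤ ∫⁻ y, eLpNorm (fun x => F x y) p μ ∂ν := by
  simp only [eLpNorm_eq_lintegral_rpow hp hp']
  refine lintegral_rpow_lintegral_le F hF _ ?_
  rw [← ENNReal.toReal_one]
  exact ENNReal.toReal_mono hp' hp

end Minkowski

/-! ### Young's inequality in mixed Lebesgue norms. -/

section MixedNorm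

variable {V : Type} [NormedAddCommGroup V] [InnerProductSpace ℝ V] [FiniteDimensional ℝ V]
  [MeasurableSpace V] [BorelSpace V]

theorem eLpNorm_add_right_eq_self (p : ℝ≥0∞) {f : V → ℝ≥0∞} (hf : Measurable f) (y : V) :
    eLpNorm (fun x => f (x + y)) p volume = eLpNorm f p volume :=
  eLpNorm_comp_measurePreserving hf.aestronglyMeasurable
    (measurePreserving_add_right (volume : Measure V) y)

/-- A continuous function is everywhere bounded by its essential supremum. -/
theorem le_eLpNorm_top_of_continuous {f : V → ℝ≥0∞} (hf : Continuous f) (x : V) :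
    f x ≤ eLpNorm f ⊤ volume := by
  rw [eLpNorm_exponent_top]
  have h1 : ∀ᵐ x, f x ≤ eLpNormEssSup f volume := by
    have := enorm_ae_le_eLpNormEssSup f (volume : Measure V)
    simpa using this
  have hd := Measure.dense_of_ae h1
  have hc : IsClosed {x | f x ≤ eLpNormEssSup f volume} := isClosed_le hf continuous_const
  have hx : x ∈ closure {x | f x ≤ eLpNormEssSup f volume} := hd x
  rwa [hc.closure_eq] at hx

/-- For `p = ∞` continuity in `x` makes the essential supremum a supremum over a countable dense
set; for finite `p` the claim is Tonelli. -/
theorem measurable_eLpNorm_left {p : ℝ≥0∞} (hp : 1 ≤ p) {F : V → V → ℝ≥0∞}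
    (hF : Measurable (Function.uncurry F)) (hc : ∀ ξ, Continuous fun x => F x ξ) :
    Measurable fun ξ => eLpNorm (fun x => F x ξ) p volume := by
  by_cases hp' : p = ⊤
  · subst hp'
    have : (fun ξ => eLpNorm (fun x => F x ξ) ⊤ volume) =
        fun ξ => ⨆ n : ℕ, F (TopologicalSpace.denseSeq V n) ξ := by
      ext ξ
      refine le_antisymm ?_ (iSup_le fun n => le_eLpNorm_top_of_continuous (hc ξ) _)
      rw [eLpNorm_exponent_top]
      refine eLpNormEssSup_le_of_ae_enorm_bound (Filter.Eventually.of_forall fun x => ?_)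
      rw [enorm_eq_self]
      have hcl : IsClosed {x | F x ξ ≤ ⨆ n : ℕ, F (TopologicalSpace.denseSeq V n) ξ} :=
        isClosed_le (hc ξ) continuous_const
      have hsub : Set.range (TopologicalSpace.denseSeq V) ⊆
          {x | F x ξ ≤ ⨆ n : ℕ, F (TopologicalSpace.denseSeq V n) ξ} := by
        rintro _ ⟨n, rfl⟩
        exact le_iSup (fun n => F (TopologicalSpace.denseSeq V n) ξ) n
      have := hcl.closure_subset_iff.2 hsub
      rw [(TopologicalSpace.denseRange_denseSeq V).closure_range] at this
      exact this (Set.mem_univ x)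
    rw [this]
    exact Measurable.iSup fun n => hF.comp measurable_prodMk_left
  · simp only [eLpNorm_eq_lintegral_rpow hp hp']
    exact measurable_lintegral_rpow_left F hF _

/-- Minkowski moves the `L^p` norm in `x` inside, where translation by `y` disappears. What remains
is a convolution in frequency alone. -/
theorem eLpNorm_le_of_le_convolution {p : ℝ≥0∞} (hp : 1 ≤ p) {F G : V → V → ℝ≥0∞}
    (hF : Measurable (Function.uncurry F)) (hc : ∀ ξ, Continuous fun x => F x ξ)
    {a : V → ℝ≥0∞} (ha : Measurable a)
    (hG : ∀ x ξ, G x ξ ≤ ∫⁻ y, ∫⁻ η, a y * a η * F (x + y) (ξ - η)) (ξ : V) :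
    eLpNorm (fun x => G x ξ) p volume ≤
      (∫⁻ y, a y) * ∫⁻ η, a η * eLpNorm (fun x => F x (ξ - η)) p volume := by
  have hN := measurable_eLpNorm_left hp hF hc
  set N : V → ℝ≥0∞ := fun ξ => eLpNorm (fun x => F x ξ) p volume
  have hNm : Measurable fun η => a η * N (ξ - η) := ha.mul (hN.comp (by fun_prop))
  have e : (∫⁻ y, a y) * ∫⁻ η, a η * N (ξ - η) = ∫⁻ y, ∫⁻ η, a y * a η * N (ξ - η) := by
    rw [← lintegral_mul_const _ ha]
    refine lintegral_congr fun y => ?_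
    rw [← lintegral_const_mul _ hNm]
    simp only [mul_assoc]
  rw [e]
  by_cases hp' : p = ⊤
  · subst hp'
    rw [eLpNorm_exponent_top]
    refine eLpNormEssSup_le_of_ae_enorm_bound (Filter.Eventually.of_forall fun x => ?_)
    rw [enorm_eq_self]
    refine (hG x ξ).trans (lintegral_mono fun y => lintegral_mono fun η => ?_)
    -- Continuity bounds `F` at every point by its essential supremum, so no exceptional set
    -- depending on `η` has to be handled.
    exact mul_le_mul_right (le_eLpNorm_top_of_continuous (hc (ξ - η)) (x + y)) _
  · have hmeas : Measurable fun z : V × (V × V) =>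
        a z.2.1 * a z.2.2 * F (z.1 + z.2.1) (ξ - z.2.2) := by
      have h1 : Measurable fun z : V × (V × V) => F (z.1 + z.2.1) (ξ - z.2.2) :=
        hF.comp (by fun_prop : Measurable fun z : V × (V × V) => (z.1 + z.2.1, ξ - z.2.2))
      fun_prop
    have hmeas' : ∀ x, Measurable fun z : V × V => a z.1 * a z.2 * F (x + z.1) (ξ - z.2) :=
      fun x => hmeas.comp measurable_prodMk_left
    have h1 : eLpNorm (fun x => G x ξ) p volume ≤
        eLpNorm (fun x => ∫⁻ z : V × V, a z.1 * a z.2 * F (x + z.1) (ξ - z.2)) p volume := by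
      refine eLpNorm_mono_enorm fun x => ?_
      simp only [enorm_eq_self]
      refine (hG x ξ).trans (le_of_eq ?_)
      rw [Measure.volume_eq_prod, lintegral_prod _ (hmeas' x).aemeasurable]
    refine h1.trans ((eLpNorm_lintegral_le hp hp' _ hmeas).trans (le_of_eq ?_))
    have h2 : ∀ z : V × V, eLpNorm (fun x => a z.1 * a z.2 * F (x + z.1) (ξ - z.2)) p volume =
        a z.1 * a z.2 * N (ξ - z.2) := by
      intro z
      have hm : Measurable fun x => F x (ξ - z.2) := hF.comp measurable_prodMk_right
      have hm' : Measurable fun x => F (x + z.1) (ξ - z.2) := hm.comp (measurable_add_const z.1)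
      rw [eLpNorm_const_mul_of_measurable hp _ hm', eLpNorm_add_right_eq_self p hm z.1]
    simp only [h2]
    rw [Measure.volume_eq_prod, lintegral_prod]
    have : Measurable fun z : V × V => N (ξ - z.2) := hN.comp (by fun_prop)
    exact Measurable.aemeasurable (by fun_prop)

/-- Young's inequality `L¹ * L^q ⊆ L^q`, by Minkowski for finite `q`. For `q = ∞` the null set of
bad points is pulled back along `η ↦ ξ - η`. -/
theorem eLpNorm_convolution_le {q : ℝ≥0∞} (hq : 1 ≤ q) {a N : V → ℝ≥0∞} (ha : Measurable a)
    (hN : Measurable N) :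
    eLpNorm (fun ξ => ∫⁻ η, a η * N (ξ - η)) q volume ≤ (∫⁻ y, a y) * eLpNorm N q volume := by
  by_cases hq' : q = ⊤
  · subst hq'
    rw [eLpNorm_exponent_top, eLpNorm_exponent_top]
    refine eLpNormEssSup_le_of_ae_enorm_bound (Filter.Eventually.of_forall fun ξ => ?_)
    rw [enorm_eq_self, ← lintegral_mul_const _ ha]
    refine lintegral_mono_ae ?_
    have h1 : ∀ᵐ x, N x ≤ eLpNormEssSup N volume := by
      have := enorm_ae_le_eLpNormEssSup N (volume : Measure V)
      simpa using this
    have h2 :=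
      (Measure.measurePreserving_sub_left (volume : Measure V) ξ).quasiMeasurePreserving.ae h1
    filter_upwards [h2] with η hη
    exact mul_le_mul_right hη _
  · have hm : Measurable fun z : V × V => N (z.1 - z.2) := hN.comp (by fun_prop)
    refine (eLpNorm_lintegral_le hq hq' (fun ξ η => a η * N (ξ - η))
      (by simp only [Function.uncurry_def]; fun_prop)).trans (le_of_eq ?_)
    rw [← lintegral_mul_const _ ha]
    refine lintegral_congr fun η => ?_
    have hm' : Measurable fun ξ => N (ξ - η) := hN.comp (measurable_sub_const η)
    rw [eLpNorm_const_mul_of_measurable hq _ hm']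
    simp only [sub_eq_add_neg]
    rw [eLpNorm_add_right_eq_self q hN]

/-- Young's inequality in mixed-norm spaces, for an integrable kernel of product form. -/
theorem eLpNorm_eLpNorm_le_of_le_convolution {p q : ℝ≥0∞} (hp : 1 ≤ p) (hq : 1 ≤ q)
    {F G : V → V → ℝ≥0∞} (hF : Measurable (Function.uncurry F))
    (hc : ∀ ξ, Continuous fun x => F x ξ) {a : V → ℝ≥0∞} (ha : Measurable a)
    (hG : ∀ x ξ, G x ξ ≤ ∫⁻ y, ∫⁻ η, a y * a η * F (x + y) (ξ - η)) :
    eLpNorm (fun ξ => eLpNorm (fun x => G x ξ) p volume) q volume ≤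
      (∫⁻ y, a y) * ((∫⁻ y, a y) *
        eLpNorm (fun ξ => eLpNorm (fun x => F x ξ) p volume) q volume) := by
  have hN := measurable_eLpNorm_left hp hF hc
  have hm : Measurable fun ξ => ∫⁻ η, a η * eLpNorm (fun x => F x (ξ - η)) p volume := by
    have h1 : Measurable fun z : V × V => eLpNorm (fun x => F x (z.1 - z.2)) p volume :=
      hN.comp (by fun_prop : Measurable fun z : V × V => z.1 - z.2)
    exact Measurable.lintegral_prod_right' (f := fun z : V × V =>
      a z.2 * eLpNorm (fun x => F x (z.1 - z.2)) p volume) (by fun_prop)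
  refine (eLpNorm_mono_enorm (g := fun ξ => (∫⁻ y, a y) *
    ∫⁻ η, a η * eLpNorm (fun x => F x (ξ - η)) p volume) fun ξ => ?_).trans ?_
  · simp only [enorm_eq_self]
    exact eLpNorm_le_of_le_convolution hp hF hc ha hG ξ
  · rw [eLpNorm_const_mul_of_measurable hq _ hm]
    exact mul_le_mul_right (eLpNorm_convolution_le hq ha hN) _

end MixedNorm

/-! ### Regularity of the short-time Fourier transform and independence of the window. -/

section WindowIndependence

variable {V : Type} [NormedAddCommGroup V] [InnerProductSpace ℝ V] [FiniteDimensional ℝ V]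

theorem continuous_apply_compSubConst (G : 𝓢(V, ℂ) →L[ℂ] ℂ) (b : 𝓢(V, ℂ)) :
    Continuous fun x : V => G (b.compSubConstCLM ℂ x) := by
  rw [continuous_iff_continuousAt]
  intro x
  obtain ⟨L, hL, -⟩ := hasFDerivAt_translate G (b.compSubConstCLM ℂ x)
  have h1 : ContinuousAt (fun a : V => G ((b.compSubConstCLM ℂ x).compSubConstCLM ℂ (-a)))
      (x - x) := by
    rw [sub_self]; exact hL.continuousAt
  have h2 : ContinuousAt (fun y : V => x - y) x := by fun_prop
  refine (ContinuousAt.comp (f := fun y : V => x - y) h1 h2).congr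
    (Filter.Eventually.of_forall fun y => ?_)
  simp only [Function.comp_apply]
  congr 1
  ext t
  simp

theorem continuous_stft_left (g : 𝓢(V, ℂ)) (u : 𝓢'(V, ℂ)) (ξ : V) :
    Continuous fun x => stft g u x ξ := by
  simp only [stft_eq]
  exact continuous_apply_compSubConst
    ((u : 𝓢(V, ℂ) →L[ℂ] ℂ).comp (SchwartzMap.smulLeftCLM ℂ (fun t : V =>
      Complex.exp (((2 * Real.pi * inner ℝ (-ξ) t : ℝ) : ℂ) * Complex.I)))) (conjS g)

variable [MeasurableSpace V] [BorelSpace V]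

theorem fourier_timeFreqShift (x ξ : V) (h : 𝓢(V, ℂ)) :
    𝓕 (timeFreqShift x ξ h) =
      Complex.exp (((2 * Real.pi * inner ℝ x ξ : ℝ) : ℂ) * Complex.I) •
        timeFreqShift ξ (-x) (𝓕 h) := by
  ext w
  rw [smul_apply, timeFreqShift_apply, smul_eq_mul, SchwartzMap.fourier_coe,
    SchwartzMap.fourier_coe, Real.fourier_eq', Real.fourier_eq', ← integral_const_mul,
    ← integral_const_mul]
  conv_rhs => rw [← integral_sub_right_eq_self _ x]
  refine integral_congr_ae (Filter.Eventually.of_forall fun t => ?_)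
  simp only [timeFreqShift_apply, smul_eq_mul]
  rw [← mul_assoc, ← mul_assoc, ← mul_assoc, ← Complex.exp_add, ← Complex.exp_add,
    ← Complex.exp_add]
  congr 2
  simp only [inner_sub_left, inner_sub_right, inner_neg_left, real_inner_comm t ξ]
  push_cast
  ring

/-- Conjugation by the Fourier transform turns the modulation into a translation, for which
continuity is already known. -/
theorem continuous_stft_right (g : 𝓢(V, ℂ)) (u : 𝓢'(V, ℂ)) (x : V) :
    Continuous fun ξ => stft g u x ξ := by
  have h1 : ∀ ξ, stft g u x ξ =
      u (𝓕⁻ ((𝓕 (timeFreqShift x 0 (conjS g))).compSubConstCLM ℂ (-ξ))) := by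
    intro ξ
    have e : timeFreqShift x (-ξ) (conjS g) =
        timeFreqShift 0 (-ξ) (timeFreqShift x 0 (conjS g)) := by
      ext t; simp
    have e' : 𝓕 (timeFreqShift 0 (-ξ) (timeFreqShift x 0 (conjS g))) =
        (𝓕 (timeFreqShift x 0 (conjS g))).compSubConstCLM ℂ (-ξ) := by
      rw [fourier_timeFreqShift]
      ext t; simp
    rw [stft_eq, ← e', FourierTransform.fourierInv_fourier_eq, e]
  simp only [h1]
  exact (continuous_apply_compSubConst ((u : 𝓢(V, ℂ) →L[ℂ] ℂ).comp
    (FourierTransform.fourierInvCLM ℂ 𝓢(V, ℂ))) _).comp continuous_neg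

/-- Separate continuity suffices for joint measurability (a Carathéodory function), so joint
continuity is not needed. -/
theorem measurable_uncurry_enorm_stft (g : 𝓢(V, ℂ)) (u : 𝓢'(V, ℂ)) :
    Measurable (Function.uncurry fun x ξ => ‖stft g u x ξ‖ₑ) :=
  measurable_uncurry_of_continuous_of_measurable
    (fun ξ => (continuous_stft_left g u ξ).enorm)
    (fun x => (continuous_stft_right g u x).enorm.measurable)

theorem modulationSpace_subset (g g₁ : 𝓢(V, ℂ)) (hg : g ≠ 0) (p q : ℝ≥0∞) (hp : 1 ≤ p)
    (hq : 1 ≤ q) : modulationSpace g p q ⊆ modulationSpace g₁ p q := by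
  intro u hu
  obtain ⟨a, ha, hai, hle⟩ := exists_enorm_stft_le g g₁ hg
  have key := eLpNorm_eLpNorm_le_of_le_convolution hp hq
    (measurable_uncurry_enorm_stft g u) (fun ξ => (continuous_stft_left g u ξ).enorm) ha
    (G := fun x ξ => ‖stft g₁ u x ξ‖ₑ) (hle u)
  simp only [eLpNorm_enorm] at key
  exact key.trans_lt (ENNReal.mul_lt_top hai (ENNReal.mul_lt_top hai hu))

/-- Modulation spaces do not depend on the window. -/
theorem modulationSpace_eq (g g₁ : 𝓢(V, ℂ)) (hg : g ≠ 0) (hg₁ : g₁ ≠ 0) (p q : ℝ≥0∞)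
    (hp : 1 ≤ p) (hq : 1 ≤ q) : modulationSpace g p q = modulationSpace g₁ p q :=
  (modulationSpace_subset g g₁ hg p q hp hq).antisymm
    (modulationSpace_subset g₁ g hg₁ p q hp hq)

end WindowIndependence

/-! ### Fourier multipliers with quadratic phase acting on modulation spaces. -/

section Multiplier

variable {V : Type} [NormedAddCommGroup V] [InnerProductSpace ℝ V] [FiniteDimensional ℝ V]
  [MeasurableSpace V] [BorelSpace V]

/-- A unimodular character of second degree, with symmetric part `B`. -/
structure IsQuadraticCharacter (c : V → ℂ) (B : V → V) : Prop where
  temperate : c.HasTemperateGrowth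
  norm_eq_one : ∀ z, ‖c z‖ = 1
  apply_add : ∀ z h, c (z + h) = c z * c h *
    Complex.exp (((2 * Real.pi * inner ℝ (B h) z : ℝ) : ℂ) * Complex.I)

/-- The transposed Fourier multiplier applied to a window. -/
def multiplierWindow (c : V → ℂ) (g : 𝓢(V, ℂ)) : 𝓢(V, ℂ) :=
  conjS (𝓕 (SchwartzMap.smulLeftCLM ℂ c (𝓕⁻ (conjS g))))

/-- Every step in the construction of the window is injective; for multiplication by `c` this is
because `|c| = 1`. -/
theorem multiplierWindow_ne_zero {c : V → ℂ} {B : V → V} (hc : IsQuadraticCharacter c B)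
    {g : 𝓢(V, ℂ)} (hg : g ≠ 0) : multiplierWindow c g ≠ 0 := by
  intro h
  have h1 : 𝓕 (SchwartzMap.smulLeftCLM ℂ c (𝓕⁻ (conjS g))) = 0 := by
    rw [← conjS_conjS (𝓕 _)]
    change conjS (multiplierWindow c g) = 0
    rw [h, map_zero]
  have h2 : SchwartzMap.smulLeftCLM ℂ c (𝓕⁻ (conjS g)) = 0 := by
    have e := FourierTransform.fourierInv_fourier_eq (F := 𝓢(V, ℂ))
      (SchwartzMap.smulLeftCLM ℂ c (𝓕⁻ (conjS g)))
    rw [h1] at e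
    exact e.symm.trans (map_zero (FourierTransform.fourierInvCLM ℂ 𝓢(V, ℂ)))
  have h3 : 𝓕⁻ (conjS g) = 0 := by
    ext t
    have := congrArg (fun f : 𝓢(V, ℂ) => f t) h2
    simp only [SchwartzMap.smulLeftCLM_apply_apply hc.temperate, smul_eq_mul, zero_apply,
      mul_eq_zero] at this
    refine this.resolve_left fun h0 => ?_
    have := hc.norm_eq_one t
    simp [h0] at this
  have h4 : conjS g = 0 := by
    have e := FourierTransform.fourier_fourierInv_eq (F := 𝓢(V, ℂ)) (conjS g)
    rw [h3] at e
    exact e.symm.trans (map_zero (FourierTransform.fourierCLM ℂ 𝓢(V, ℂ)))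
  apply hg
  rw [← conjS_conjS g, h4, map_zero]

/-- The inverse Fourier transform turns translation by `x` into modulation by `x` and modulation by
`-ξ` into translation by `ξ`. By the functional equation, `c(w) / c(w - ξ)` is a constant times the
character with frequency `B ξ`, so multiplication by `c` raises the modulation to `x + B ξ`;
transforming back gives the sheared shift. -/
theorem exists_multiplier_timeFreqShift {c : V → ℂ} {B : V → V} (hc : IsQuadraticCharacter c B)
    (x ξ : V) (b : 𝓢(V, ℂ)) :
    ∃ θ : ℂ, ‖θ‖ = 1 ∧ 𝓕 (SchwartzMap.smulLeftCLM ℂ c (𝓕⁻ (timeFreqShift x (-ξ) b))) =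
      θ • timeFreqShift (x + B ξ) (-ξ) (𝓕 (SchwartzMap.smulLeftCLM ℂ c (𝓕⁻ b))) := by
  set β := 𝓕⁻ b
  have hb : b = 𝓕 β := (FourierTransform.fourier_fourierInv_eq b).symm
  let e : ℝ → ℂ := fun r => Complex.exp (r * Complex.I)
  have he : ∀ r, ‖e r‖ = 1 := Complex.norm_exp_ofReal_mul_I
  have h0 : ∀ r, e r ≠ 0 := fun r => Complex.exp_ne_zero _
  have h1 : timeFreqShift x (-ξ) b = (e (2 * Real.pi * inner ℝ ξ x))⁻¹ •
      𝓕 (timeFreqShift ξ x β) := by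
    rw [fourier_timeFreqShift, ← hb, smul_smul, inv_mul_cancel₀ (h0 _), one_smul]
  have h2 : 𝓕⁻ (timeFreqShift x (-ξ) b) = (e (2 * Real.pi * inner ℝ ξ x))⁻¹ •
      timeFreqShift ξ x β := by
    rw [h1, FourierTransform.fourierInv_smul, FourierTransform.fourierInv_fourier_eq]
  have h3 : SchwartzMap.smulLeftCLM ℂ c (timeFreqShift ξ x β) =
      (c ξ * (e (2 * Real.pi * inner ℝ (B ξ) ξ))⁻¹) •
        timeFreqShift ξ (x + B ξ) (SchwartzMap.smulLeftCLM ℂ c β) := by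
    ext w
    simp only [smul_apply, SchwartzMap.smulLeftCLM_apply_apply hc.temperate, timeFreqShift_apply,
      smul_eq_mul]
    have h4 := hc.apply_add (w - ξ) ξ
    rw [sub_add_cancel] at h4
    rw [h4]
    have h5 : Complex.exp (((2 * Real.pi * inner ℝ (B ξ) (w - ξ) : ℝ) : ℂ) * Complex.I) *
        Complex.exp (((2 * Real.pi * inner ℝ x w : ℝ) : ℂ) * Complex.I) =
        (e (2 * Real.pi * inner ℝ (B ξ) ξ))⁻¹ *
          Complex.exp (((2 * Real.pi * inner ℝ (x + B ξ) w : ℝ) : ℂ) * Complex.I) := by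
      simp only [e]
      rw [← Complex.exp_neg, ← Complex.exp_add, ← Complex.exp_add]
      congr 1
      simp only [inner_sub_right, inner_add_left]
      push_cast
      ring
    linear_combination (c (w - ξ) * c ξ * β (w - ξ)) * h5
  refine ⟨(e (2 * Real.pi * inner ℝ ξ x))⁻¹ * ((c ξ * (e (2 * Real.pi * inner ℝ (B ξ) ξ))⁻¹) *
    e (2 * Real.pi * inner ℝ ξ (x + B ξ))), ?_, ?_⟩
  · simp only [norm_mul, norm_inv, he, hc.norm_eq_one]
    norm_num
  · rw [h2, map_smul, h3, FourierTransform.fourier_smul, FourierTransform.fourier_smul,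
      fourier_timeFreqShift, smul_smul, smul_smul, mul_assoc]

/-- A Fourier multiplier that is a character of second degree shears the short-time Fourier
transform, up to a change of window. -/
theorem norm_stft_fourierMultiplier {c : V → ℂ} {B : V → V} (hc : IsQuadraticCharacter c B)
    (g : 𝓢(V, ℂ)) (u : 𝓢'(V, ℂ)) (x ξ : V) :
    ‖stft g (TemperedDistribution.fourierMultiplierCLM ℂ c u) x ξ‖ =
      ‖stft (multiplierWindow c g) u (x + B ξ) ξ‖ := by
  obtain ⟨θ, hθ, h⟩ := exists_multiplier_timeFreqShift hc x ξ (conjS g)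
  rw [stft_eq, TemperedDistribution.fourierMultiplierCLM_apply_apply, h, map_smul, norm_smul, hθ,
    one_mul, stft_eq, multiplierWindow, conjS_conjS]

/-- At fixed `ξ` the shear is the translation `x ↦ x + B ξ`, which preserves the inner `L^p` norm.
Only the change of window is left. -/
theorem fourierMultiplier_mem_modulationSpace_iff {c : V → ℂ} {B : V → V}
    (hc : IsQuadraticCharacter c B) (g : 𝓢(V, ℂ)) (hg : g ≠ 0) (u : 𝓢'(V, ℂ)) (p q : ℝ≥0∞)
    (hp : 1 ≤ p) (hq : 1 ≤ q) :
    TemperedDistribution.fourierMultiplierCLM ℂ c u ∈ modulationSpace g p q ↔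
      u ∈ modulationSpace g p q := by
  have : ∀ ξ, eLpNorm (fun x => stft g (TemperedDistribution.fourierMultiplierCLM ℂ c u) x ξ)
      p volume = eLpNorm (fun x => stft (multiplierWindow c g) u x ξ) p volume := by
    intro ξ
    rw [← eLpNorm_comp_measurePreserving
      (continuous_stft_left (multiplierWindow c g) u ξ).aestronglyMeasurable
      (measurePreserving_add_right (volume : Measure V) (B ξ))]
    exact eLpNorm_congr_norm_ae
      (Filter.Eventually.of_forall fun x => norm_stft_fourierMultiplier hc g u x ξ)
  have h2 : TemperedDistribution.fourierMultiplierCLM ℂ c u ∈ modulationSpace g p q ↔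
      u ∈ modulationSpace (multiplierWindow c g) p q := by
    simp only [modulationSpace, Set.mem_ofPred_eq, this]
  rw [h2, modulationSpace_eq g (multiplierWindow c g) hg (multiplierWindow_ne_zero hc hg) p q hp hq]

end Multiplier

/-! ### The Cohen kernel and the Wigner distributions as images of one Fourier multiplier. -/

section Cohen

variable {d : ℕ}

/-- The identification of the `ℓ²` product `ℝ^d × ℝ^d` with `ℝ^{2d}`. -/
def pairIsometry (d : ℕ) : WithLp 2 (Rd d × Rd d) ≃ₗᵢ[ℝ] Rdd d where
  toFun z := pair z.fst z.snd
  invFun z := WithLp.toLp 2 (fstL z, sndL z)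
  map_add' z w := by simp [pair_eq]; abel
  map_smul' r z := by simp [pair_eq]
  left_inv z := by simp only [fstL_pair, sndL_pair]; rfl
  right_inv z := pair_fstL_sndL z
  norm_map' z := by
    refine (sq_eq_sq₀ (norm_nonneg _) (norm_nonneg _)).1 ?_
    rw [WithLp.prod_norm_sq_eq_of_L2]
    exact norm_sq_pair _ _

/-- The map passes through the `ℓ²` product, where it is an isometry; the sup-norm and `ℓ²` products
carry the same volume. -/
theorem measurePreserving_pair :
    MeasurePreserving (fun z : Rd d × Rd d => pair z.1 z.2) volume volume :=
  (pairIsometry d).measurePreserving.comp (WithLp.volume_preserving_toLp (Rd d) (Rd d))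

theorem measurableEmbedding_pair :
    MeasurableEmbedding fun z : Rd d × Rd d => pair z.1 z.2 :=
  (pairIsometry d).toHomeomorph.measurableEmbedding.comp
    (MeasurableEquiv.toLp 2 (Rd d × Rd d)).measurableEmbedding

theorem integral_eq_integral_pair (F : Rdd d → ℂ) (hF : Integrable F) :
    ∫ z, F z = ∫ x, ∫ y, F (pair x y) := by
  rw [← measurePreserving_pair.integral_comp measurableEmbedding_pair, Measure.volume_eq_prod,
    integral_prod]
  rw [← Measure.volume_eq_prod]
  exact (measurePreserving_pair.integrable_comp_emb measurableEmbedding_pair).2 hF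

theorem norm_inlL_apply (x : Rd d) : ‖inlL x‖ = ‖x‖ := by
  have h : inlL x = pair x 0 := by rw [pair_eq]; simp
  have := norm_sq_pair x 0
  rw [← h, norm_zero, zero_pow two_ne_zero, add_zero] at this
  exact (sq_eq_sq₀ (norm_nonneg _) (norm_nonneg _)).1 this

/-- The section `x ↦ Φ(x, y)` of a Schwartz function on `ℝ^{2d}`. -/
def sliceSnd (y : Rd d) : 𝓢(Rdd d, ℂ) →L[ℂ] 𝓢(Rd d, ℂ) :=
  SchwartzMap.compCLMOfAntilipschitz ℂ (K := 1) (g := fun x => pair x y)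
    (by simp only [pair_eq]; fun_prop)
    (AntilipschitzWith.of_le_mul_dist fun x x' => by
      simp [pair_eq, dist_eq_norm, ← map_sub, norm_inlL_apply])

@[simp]
theorem sliceSnd_apply (y : Rd d) (Φ : 𝓢(Rdd d, ℂ)) (x : Rd d) :
    sliceSnd y Φ x = Φ (pair x y) := rfl

/-- By Fubini, transforming the first block after `ℱ₂` gives the full Fourier transform. Inverting
this partial transform expresses `ℱ₂ φ` through `𝓕 φ`, where multipliers act. -/
theorem fourier_sliceSnd_partialFourierSchwartz (φ : 𝓢(Rdd d, ℂ)) (y ζ : Rd d) :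
    𝓕 (sliceSnd y (partialFourierSchwartz φ)) ζ = 𝓕 φ (pair ζ y) := by
  rw [SchwartzMap.fourier_coe, SchwartzMap.fourier_coe, Real.fourier_eq', Real.fourier_eq',
    integral_eq_integral_pair]
  · refine integral_congr_ae (Filter.Eventually.of_forall fun x => ?_)
    simp only [sliceSnd_apply, partialFourierSchwartz_apply, smul_eq_mul]
    rw [← integral_const_mul]
    refine integral_congr_ae (Filter.Eventually.of_forall fun t => ?_)
    dsimp only
    rw [← mul_assoc, ← Complex.exp_add, inner_eq_add, fstL_pair, fstL_pair, sndL_pair, sndL_pair]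
    congr 2
    push_cast
    ring
  · have := (Real.fourierIntegral_convergent_iff (μ := volume) (f := φ) (pair ζ y)).2 φ.integrable
    refine this.congr (Filter.Eventually.of_forall fun z => ?_)
    simp [Real.fourierChar_apply, Circle.smul_def]

theorem partialFourierSchwartz_eq_integral (φ : 𝓢(Rdd d, ℂ)) (x y : Rd d) :
    partialFourierSchwartz φ (pair x y) =
      ∫ ζ, Complex.exp (((2 * Real.pi * inner ℝ ζ x : ℝ) : ℂ) * Complex.I) * 𝓕 φ (pair ζ y) := by
  have h : 𝓕⁻ (𝓕 (sliceSnd y (partialFourierSchwartz φ))) x =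
      partialFourierSchwartz φ (pair x y) := by
    rw [FourierTransform.fourierInv_fourier_eq, sliceSnd_apply]
  rw [← h, SchwartzMap.fourierInv_coe, Real.fourierInv_eq']
  refine integral_congr_ae (Filter.Eventually.of_forall fun ζ => ?_)
  simp only [fourier_sliceSnd_partialFourierSchwartz, smul_eq_mul]

/-- The chirp `(z₁, z₂) ↦ e^{-2πi z₁·M z₂}`, which is `χ_M ∘ J`. -/
def dualChirp (M : Matrix (Fin d) (Fin d) ℝ) (z : Rdd d) : ℂ :=
  Complex.exp (((-(2 * Real.pi * inner ℝ (fstL z) (Matrix.toEuclideanLin M (sndL z))) : ℝ) : ℂ) *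
    Complex.I)

/-- The linear map `(z₁, z₂) ↦ (-M z₂, -Mᵀ z₁)`. -/
def dualChirpMap (M : Matrix (Fin d) (Fin d) ℝ) : Rdd d →ₗ[ℝ] Rdd d :=
  -((inlL : Rd d →L[ℝ] Rdd d).toLinearMap ∘ₗ Matrix.toEuclideanLin M ∘ₗ
      (sndL : Rdd d →L[ℝ] Rd d).toLinearMap) -
    (inrL : Rd d →L[ℝ] Rdd d).toLinearMap ∘ₗ (Matrix.toEuclideanLin M).adjoint ∘ₗ
      (fstL : Rdd d →L[ℝ] Rd d).toLinearMap

theorem dualChirpMap_apply (M : Matrix (Fin d) (Fin d) ℝ) (z : Rdd d) :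
    dualChirpMap M z = pair (-(Matrix.toEuclideanLin M (sndL z)))
      (-((Matrix.toEuclideanLin M).adjoint (fstL z))) := by
  simp only [dualChirpMap, pair_eq, map_neg]
  rw [sub_eq_add_neg]
  rfl

theorem hasTemperateGrowth_dualChirp (M : Matrix (Fin d) (Fin d) ℝ) :
    Function.HasTemperateGrowth (dualChirp M) := by
  have h : Function.HasTemperateGrowth fun z : Rdd d =>
      -(2 * Real.pi * (innerSL ℝ (fstL z) (LinearMap.toContinuousLinearMap
        (Matrix.toEuclideanLin M) (sndL z)) : ℝ)) := by
    refine ((Function.HasTemperateGrowth.const _).mul ?_).neg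
    exact ContinuousLinearMap.bilinear_hasTemperateGrowth (𝕜 := ℝ) (innerSL ℝ)
      fstL.hasTemperateGrowth
      ((LinearMap.toContinuousLinearMap (Matrix.toEuclideanLin M)).comp sndL).hasTemperateGrowth
  exact hasTemperateGrowth_cexp_ofReal_mul_I.comp h

theorem isQuadraticCharacter_dualChirp (M : Matrix (Fin d) (Fin d) ℝ) :
    IsQuadraticCharacter (dualChirp M) (dualChirpMap M) where
  temperate := hasTemperateGrowth_dualChirp M
  norm_eq_one z := Complex.norm_exp_ofReal_mul_I _
  apply_add z h := by
    rw [dualChirpMap_apply, inner_eq_add, fstL_pair, sndL_pair, dualChirp, dualChirp, dualChirp,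
      ← Complex.exp_add, ← Complex.exp_add]
    congr 1
    simp only [map_add, inner_add_left, inner_add_right, inner_neg_left, inner_neg_right,
      LinearMap.adjoint_inner_left, real_inner_comm (fstL z)]
    push_cast
    ring

theorem dualChirp_neg (M : Matrix (Fin d) (Fin d) ℝ) (z : Rdd d) :
    dualChirp M (-z) = dualChirp M z := by
  simp [dualChirp]

theorem fourier_fourier_apply {V : Type} [NormedAddCommGroup V] [InnerProductSpace ℝ V]
    [FiniteDimensional ℝ V] [MeasurableSpace V] [BorelSpace V] (φ : 𝓢(V, ℂ)) (z : V) :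
    𝓕 (𝓕 φ) z = φ (-z) := by
  have h : 𝓕⁻ (𝓕 φ) (-z) = φ (-z) := by rw [FourierTransform.fourierInv_fourier_eq]
  rw [← h, SchwartzMap.fourierInv_coe, Real.fourierInv_eq_fourier_neg, neg_neg,
    SchwartzMap.fourier_coe]

/-- In the integral over `ζ`, the symbol contributes `e^{-2πi ζ·My}`, which merges with `e^{2πi
ζ·x}` into a translation of `x` by `-My`. The symbol is even, so the reflection coming from `𝓕 𝓕`
does no harm. -/
theorem partialFourierSchwartz_multiplier (M : Matrix (Fin d) (Fin d) ℝ) (φ : 𝓢(Rdd d, ℂ))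
    (x y : Rd d) :
    partialFourierSchwartz (𝓕 (SchwartzMap.smulLeftCLM ℂ (dualChirp M) (𝓕⁻ φ))) (pair x y) =
      partialFourierSchwartz φ (pair (x - Matrix.toEuclideanLin M y) y) := by
  rw [partialFourierSchwartz_eq_integral, partialFourierSchwartz_eq_integral]
  refine integral_congr_ae (Filter.Eventually.of_forall fun ζ => ?_)
  have h : 𝓕⁻ φ (-pair ζ y) = 𝓕 φ (pair ζ y) := by
    rw [SchwartzMap.fourierInv_coe, Real.fourierInv_eq_fourier_neg, neg_neg,
      SchwartzMap.fourier_coe]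
  simp only [fourier_fourier_apply,
    SchwartzMap.smulLeftCLM_apply_apply (hasTemperateGrowth_dualChirp M), dualChirp_neg, h,
    smul_eq_mul]
  rw [← mul_assoc, dualChirp, ← Complex.exp_add, fstL_pair, sndL_pair]
  congr 2
  simp only [inner_sub_right]
  push_cast
  ring

theorem toEuclideanLin_fromBlocks (A B C D : Matrix (Fin d) (Fin d) ℝ) (v : Rdd d) :
    Matrix.toEuclideanLin (Matrix.fromBlocks A B C D) v =
      pair (Matrix.toEuclideanLin A (fstL v) + Matrix.toEuclideanLin B (sndL v))
        (Matrix.toEuclideanLin C (fstL v) + Matrix.toEuclideanLin D (sndL v)) := by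
  ext i
  rw [Matrix.toLpLin_apply, Matrix.fromBlocks_mulVec]
  rcases i with i | i <;> simp [pair, Matrix.toLpLin_apply] <;> rfl

theorem det_cohenMatrix (M : Matrix (Fin d) (Fin d) ℝ) :
    (cohenMatrix M : Matrix (Fin d ⊕ Fin d) (Fin d ⊕ Fin d) ℝ).det =
      (wignerMatrix d : Matrix (Fin d ⊕ Fin d) (Fin d ⊕ Fin d) ℝ).det := by
  have h : (cohenMatrix M : Matrix (Fin d ⊕ Fin d) (Fin d ⊕ Fin d) ℝ) =
      (wignerMatrix d : Matrix (Fin d ⊕ Fin d) (Fin d ⊕ Fin d) ℝ) *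
        Matrix.fromBlocks 1 M 0 1 := by
    simp [cohenMatrix, wignerMatrix, Matrix.fromBlocks_multiply, sub_eq_add_neg]
  rw [h, Matrix.det_mul, Matrix.det_fromBlocks_zero₂₁]
  simp

/-- The two inverse matrices send `(v₁, v₂)` to points with the same second block `v₁ - v₂`, while
their first blocks differ by `-M(v₁ - v₂)`: exactly the translation that the multiplier produces. -/
theorem partialFourierSchwartz_matEquiv_symm (M : Matrix (Fin d) (Fin d) ℝ) (φ : 𝓢(Rdd d, ℂ))
    (v : Rdd d) :
    partialFourierSchwartz φ ((matEquiv (cohenMatrix M)).symm v) =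
      partialFourierSchwartz (𝓕 (SchwartzMap.smulLeftCLM ℂ (dualChirp M) (𝓕⁻ φ)))
        ((matEquiv (wignerMatrix d)).symm v) := by
  have h1 : (matEquiv (cohenMatrix M)).symm v = Matrix.toEuclideanLin
      (Matrix.fromBlocks ((1 / 2 : ℝ) • 1 - M) (M + (1 / 2 : ℝ) • 1) 1 (-1)) v := rfl
  have h2 : (matEquiv (wignerMatrix d)).symm v = Matrix.toEuclideanLin
      (Matrix.fromBlocks ((1 / 2 : ℝ) • 1) ((1 / 2 : ℝ) • 1) 1 (-1)) v := rfl
  rw [h1, h2, toEuclideanLin_fromBlocks, toEuclideanLin_fromBlocks,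
    partialFourierSchwartz_multiplier]
  congr 2
  simp only [map_sub, map_add, map_neg, LinearMap.sub_apply, LinearMap.add_apply,
    LinearMap.neg_apply, Matrix.toLpLin_one, LinearMap.id_apply]
  abel

/-- The perturbed Wigner distribution is obtained from the Wigner distribution by a Fourier
multiplier. -/
theorem perturbedWigner_eq (M : Matrix (Fin d) (Fin d) ℝ) (f : 𝓢'(Rd d, ℂ)) :
    perturbedWigner M f = TemperedDistribution.fourierMultiplierCLM ℂ (dualChirp M) (wigner f) := by
  ext φ
  rw [TemperedDistribution.fourierMultiplierCLM_apply_apply]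
  change ((|(cohenMatrix M : Matrix (Fin d ⊕ Fin d) (Fin d ⊕ Fin d) ℝ).det|⁻¹ : ℝ) : ℂ) •
      tensor f (conjD f) (SchwartzMap.compCLMOfContinuousLinearEquiv ℂ
        (matEquiv (cohenMatrix M)).symm (partialFourierSchwartz φ)) =
    ((|(wignerMatrix d : Matrix (Fin d ⊕ Fin d) (Fin d ⊕ Fin d) ℝ).det|⁻¹ : ℝ) : ℂ) •
      tensor f (conjD f) (SchwartzMap.compCLMOfContinuousLinearEquiv ℂ
        (matEquiv (wignerMatrix d)).symm (partialFourierSchwartz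
          (𝓕 (SchwartzMap.smulLeftCLM ℂ (dualChirp M) (𝓕⁻ φ)))))
  rw [det_cohenMatrix]
  congr 2
  ext v
  exact partialFourierSchwartz_matEquiv_symm M φ v

/-- The symplectic matrix as a linear isometry. -/
def symplecticIsometry (d : ℕ) : Rdd d ≃ₗᵢ[ℝ] Rdd d where
  toLinearEquiv := (matEquiv (symplecticJ d)).toLinearEquiv
  norm_map' z := by
    have h : (matEquiv (symplecticJ d)).toLinearEquiv z =
        Matrix.toEuclideanLin (Matrix.fromBlocks 0 1 (-1) 0) z := rfl
    rw [h, toEuclideanLin_fromBlocks]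
    refine (sq_eq_sq₀ (norm_nonneg _) (norm_nonneg _)).1 ?_
    conv_rhs => rw [← pair_fstL_sndL z]
    rw [norm_sq_pair, norm_sq_pair]
    simp [add_comm]

theorem symplecticIsometry_apply (z : Rdd d) :
    symplecticIsometry d z = pair (sndL z) (-(fstL z)) := by
  have h : symplecticIsometry d z =
      Matrix.toEuclideanLin (Matrix.fromBlocks 0 1 (-1) 0) z := rfl
  rw [h, toEuclideanLin_fromBlocks]
  simp

theorem abs_det_symplecticJ :
    |(symplecticJ d : Matrix (Fin d ⊕ Fin d) (Fin d ⊕ Fin d) ℝ).det| = 1 := by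
  have h : (symplecticJ d : Matrix (Fin d ⊕ Fin d) (Fin d ⊕ Fin d) ℝ) *
      (symplecticJ d : Matrix (Fin d ⊕ Fin d) (Fin d ⊕ Fin d) ℝ).transpose = 1 := by
    simp [symplecticJ, Matrix.fromBlocks_transpose, Matrix.fromBlocks_multiply]
  have h2 := congrArg Matrix.det h
  rw [Matrix.det_mul, Matrix.det_transpose, Matrix.det_one] at h2
  rw [← sq, ← sq_abs] at h2
  exact (pow_eq_one_iff_of_nonneg (abs_nonneg _) two_ne_zero).1 h2

theorem chirp_symplecticIsometry (M : Matrix (Fin d) (Fin d) ℝ) (z : Rdd d) :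
    chirp M (symplecticIsometry d z) = dualChirp M z := by
  rw [symplecticIsometry_apply, chirp, dualChirp, fstL_pair, sndL_pair, inner_neg_left, mul_neg]

/-- `J` is an isometry, so it preserves the volume and commutes with the Fourier transform; it can
be moved from the test function onto the chirp. -/
theorem theta_apply (M : Matrix (Fin d) (Fin d) ℝ) (φ : 𝓢(Rdd d, ℂ)) :
    theta M φ = ∫ z, 𝓕 φ z * dualChirp M z := by
  have h : theta M φ =
      ((|(symplecticJ d : Matrix (Fin d ⊕ Fin d) (Fin d ⊕ Fin d) ℝ).det|⁻¹ : ℝ) : ℂ) •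
        ∫ z, 𝓕 (SchwartzMap.compCLMOfContinuousLinearEquiv ℂ
          (matEquiv (symplecticJ d)).symm φ) z • chirp M z := rfl
  rw [h, abs_det_symplecticJ, inv_one, Complex.ofReal_one, one_smul,
    ← (symplecticIsometry d).measurePreserving.integral_comp
      (symplecticIsometry d).toHomeomorph.measurableEmbedding]
  refine integral_congr_ae (Filter.Eventually.of_forall fun z => ?_)
  simp only [smul_eq_mul]
  rw [chirp_symplecticIsometry]
  congr 1
  rw [SchwartzMap.fourier_coe]
  change 𝓕 (φ ∘ (symplecticIsometry d).symm) (symplecticIsometry d z) = _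
  rw [Real.fourier_comp_linearIsometry, LinearIsometryEquiv.symm_apply_apply,
    SchwartzMap.fourier_coe]

/-- The Cohen kernel is the image of the Dirac distribution under a Fourier multiplier. -/
theorem theta_eq (M : Matrix (Fin d) (Fin d) ℝ) :
    theta M = TemperedDistribution.fourierMultiplierCLM ℂ (dualChirp M)
      (TemperedDistribution.delta 0) := by
  ext φ
  rw [TemperedDistribution.fourierMultiplierCLM_apply_apply, theta_apply,
    TemperedDistribution.delta_apply, ← integral_neg_eq_self]
  conv_rhs => rw [SchwartzMap.fourier_coe, Real.fourier_eq']
  refine integral_congr_ae (Filter.Eventually.of_forall fun z => ?_)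
  have h : 𝓕⁻ φ z = 𝓕 φ (-z) := by
    rw [SchwartzMap.fourierInv_coe, Real.fourierInv_eq_fourier_neg, SchwartzMap.fourier_coe]
  simp only [SchwartzMap.smulLeftCLM_apply_apply (hasTemperateGrowth_dualChirp M), h, dualChirp_neg]
  simp [mul_comm]

/-- The transform of `δ₀` with window `g'` has modulus `|g'(-x)|`, and the multiplier shears it. -/
theorem norm_stft_theta (M : Matrix (Fin d) (Fin d) ℝ) (g : 𝓢(Rdd d, ℂ)) (x ξ : Rdd d) :
    ‖stft g (theta M) x ξ‖ =
      ‖multiplierWindow (dualChirp M) g (-(x + dualChirpMap M ξ))‖ := by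
  rw [theta_eq, norm_stft_fourierMultiplier (isQuadraticCharacter_dualChirp M), stft_eq,
    TemperedDistribution.delta_apply, timeFreqShift_apply, norm_mul, Complex.norm_exp_ofReal_mul_I,
    one_mul, conjS_apply, RCLike.norm_conj, zero_sub]

theorem theta_mem_modulationSpace (M : Matrix (Fin d) (Fin d) ℝ) (g : 𝓢(Rdd d, ℂ)) :
    theta M ∈ modulationSpace g 1 ⊤ := by
  set h := multiplierWindow (dualChirp M) g
  refine lt_of_le_of_lt ?_ (h.eLpNorm_lt_top 1)
  rw [eLpNorm_exponent_top]
  refine eLpNormEssSup_le_of_ae_enorm_bound (Filter.Eventually.of_forall fun ξ => ?_)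
  rw [enorm_eq_self]
  have e : eLpNorm (fun x => stft g (theta M) x ξ) 1 volume =
      eLpNorm (fun x => h (-(x + dualChirpMap M ξ))) 1 volume :=
    eLpNorm_congr_norm_ae (Filter.Eventually.of_forall fun x => norm_stft_theta M g x ξ)
  rw [e]
  exact le_of_eq (eLpNorm_comp_measurePreserving h.continuous.aestronglyMeasurable
    ((Measure.measurePreserving_neg (volume : Measure (Rdd d))).comp
      (measurePreserving_add_right volume (dualChirpMap M ξ))))

theorem det_dualChirpMap_ne_zero {M : Matrix (Fin d) (Fin d) ℝ} (hM : IsUnit M) :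
    LinearMap.det (dualChirpMap M) ≠ 0 := by
  have hsurj : Function.Surjective (Matrix.toEuclideanLin M) := by
    intro y
    obtain ⟨N, hN⟩ := hM.exists_right_inv
    refine ⟨Matrix.toEuclideanLin N y, ?_⟩
    rw [Matrix.toLpLin_apply, Matrix.toLpLin_apply, Matrix.mulVec_mulVec, hN, Matrix.one_mulVec]
  have hinj : Function.Injective (Matrix.toEuclideanLin M) :=
    LinearMap.injective_iff_surjective.2 hsurj
  have h : Function.Injective (dualChirpMap M) := by
    rw [← LinearMap.ker_eq_bot, LinearMap.ker_eq_bot']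
    intro z hz
    rw [dualChirpMap_apply] at hz
    have h1 := congrArg fstL hz
    have h2 := congrArg sndL hz
    rw [fstL_pair, map_zero, neg_eq_zero] at h1
    rw [sndL_pair, map_zero, neg_eq_zero] at h2
    have h3 : sndL z = 0 := hinj (by rw [h1, map_zero])
    -- The adjoint of a surjective map is injective: with `fstL z = M w`, the norm square of `fstL
    -- z` is the pairing of `Mᵀ (fstL z) = 0` with `w`.
    have h4 : fstL z = 0 := by
      obtain ⟨w, hw⟩ := hsurj (fstL z)
      have := LinearMap.adjoint_inner_left (Matrix.toEuclideanLin M) w (fstL z)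
      rw [h2, inner_zero_left, hw] at this
      exact inner_self_eq_zero.1 this.symm
    rw [← pair_fstL_sndL z, h3, h4, pair_eq, map_zero, map_zero, add_zero]
  exact (LinearEquiv.isUnit_det' (LinearEquiv.ofInjectiveEndo _ h)).ne_zero

theorem lintegral_enorm_comp_linearMap {V : Type} [NormedAddCommGroup V] [InnerProductSpace ℝ V]
    [FiniteDimensional ℝ V] [MeasurableSpace V] [BorelSpace V] (h : 𝓢(V, ℂ)) (L : V →ₗ[ℝ] V)
    (hL : LinearMap.det L ≠ 0) (x : V) :
    ∫⁻ ξ, ‖h (-(x + L ξ))‖ₑ = ENNReal.ofReal |(LinearMap.det L)⁻¹| * ∫⁻ v, ‖h v‖ₑ := by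
  have hc : Continuous fun v : V => ‖h (-(x + v))‖ₑ := by
    have := h.continuous
    fun_prop
  have hm : Measurable L := (LinearMap.continuous_of_finiteDimensional L).measurable
  have e : ∫⁻ v, ‖h (-(x + v))‖ₑ = ∫⁻ v, ‖h v‖ₑ := by
    rw [lintegral_add_left_eq_self (fun v => ‖h (-v)‖ₑ) x]
    exact lintegral_neg_eq_self (fun v => ‖h v‖ₑ)
  rw [← lintegral_map hc.measurable hm, Measure.map_linearMap_addHaar_eq_smul_addHaar _ hL,
    lintegral_smul_measure, e, smul_eq_mul]

/-- At fixed `x` the substitution `v = B ξ` is linear and invertible, so the inner norm is `|det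
B|⁻¹ ‖g'‖₁`, independent of `x`. -/
theorem theta_mem_wienerAmalgam {M : Matrix (Fin d) (Fin d) ℝ} (hM : IsUnit M)
    (g : 𝓢(Rdd d, ℂ)) : theta M ∈ wienerAmalgam g 1 ⊤ := by
  have hdet := det_dualChirpMap_ne_zero hM
  obtain ⟨h, hh⟩ : ∃ h : 𝓢(Rdd d, ℂ), ∀ x ξ,
      ‖stft g (theta M) x ξ‖ = ‖h (-(x + dualChirpMap M ξ))‖ := ⟨_, norm_stft_theta M g⟩
  have h1 : eLpNorm h 1 volume < ⊤ := (h.memLp 1 volume).eLpNorm_lt_top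
  have hK : ENNReal.ofReal |(LinearMap.det (dualChirpMap M))⁻¹| < ⊤ := ENNReal.ofReal_lt_top
  have hlt : ENNReal.ofReal |(LinearMap.det (dualChirpMap M))⁻¹| * eLpNorm h 1 volume < ⊤ :=
    ENNReal.mul_lt_top hK h1
  rw [wienerAmalgam, Set.mem_ofPred_eq, eLpNorm_exponent_top]
  refine lt_of_le_of_lt ?_ hlt
  refine eLpNormEssSup_le_of_ae_enorm_bound (Filter.Eventually.of_forall fun x => ?_)
  rw [enorm_eq_self, eLpNorm_one_eq_lintegral_enorm, eLpNorm_one_eq_lintegral_enorm,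
    ← lintegral_enorm_comp_linearMap h _ hdet x]
  refine le_of_eq (lintegral_congr fun ξ => ?_)
  rw [← ofReal_norm, ← ofReal_norm, hh]

end Cohen

end CohenClass

end

theorem theorem1p2 (d : ℕ) (M : Matrix (Fin d) (Fin d) ℝ) (hM : IsUnit M)
    (g : 𝓢(Rdd d, ℂ)) (hg : g ≠ 0) :
    theta M ∈ modulationSpace g 1 ⊤ ∩ wienerAmalgam g 1 ⊤ ∧
      ∀ (f : 𝓢'(Rd d, ℂ)) (p q : ℝ≥0∞), 1 ≤ p → 1 ≤ q →
        (wigner f ∈ modulationSpace g p q ↔ perturbedWigner M f ∈ modulationSpace g p q) := by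
  refine ⟨⟨theta_mem_modulationSpace M g, theta_mem_wienerAmalgam hM g⟩, fun f p q hp hq => ?_⟩
  rw [perturbedWigner_eq, fourierMultiplier_mem_modulationSpace_iff
    (isQuadraticCharacter_dualChirp M) g hg (wigner f) p q hp hq]
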